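/- Let $U\in\mathbb C^{d\times d}$ be unitary, let $p=(p_1,\dots,p_d)$ be a probability vector, $D_+=\mathrm{diag}(p_1,\dots,p_d)$, and $V(t)=\exp(itD_+)$ for $t\ge 0$. For a square matrix $M$ let $S_\mu^M$ be the set of unit vectors $x\in\mathbb C^n$ with $Mx=\mu x$, and write $w(x)=\sum_{i=1}^d p_i|\langle i|x\rangle|^2$. For functions $f,g$ of $t\ge0$ write $f\approx g$ if $f(0)=g(0)$ and both have right derivatives at $0$, which are equal. A *continuous labelling* is a family of continuous functions $\lambda_1,\dots,\lambda_d:[0,\infty)\to\mathbb C$ such that $\lambda_1(t),\dots,\lambda_d(t)$ are, with multiplicity, the eigenvalues of $UV(t)$ for every $t\ge0$. A *continuous eigensystem* is a family of functions $\lambda_j(t)$ and continuous $x_j(t)$, $t\ge 0$, $1\le j\le d$, such that for every $t\ge 0$ the $x_j(t)$ are an orthonormal basis of $\mathbb C^d$ with $UV(t)x_j(t)=\lambda_j(t)x_j(t)$. Let $\lambda$ be an eigenvalue of $U$ of multiplicity $k$. Continuous eigensystems exist, and the $\lambda_j$ of each of them form a continuous labelling. Moreover: (a) If $\min_{x\in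 S_\lambda^U} w(x)=0$, then $\lambda$ is an eigenvalue of $UV(t)$ for all $t\ge0$. (b) If the number $l$ of indices $i$ with $p_i>0$ is smaller than $k$, then for all $t\ge0$, $\lambda$ is an eigenvalue of $UV(t)$ of multiplicity at least $k-l$. (c) Every eigenvalue moves counterclockwise or stays in place: if $\mu:[0,\infty)\to\mathbb C$ is continuous and $\mu(t)$ is an eigenvalue of $UV(t)$ for all $t\ge0$, then $|\mu(t)|=1$ and $\mu(t)=\mu(0)e^{i\theta(t)}$ with $\theta$ continuous and nondecreasing on $[0,\infty)$, $\theta(0)=0$. If $\mu=\lambda_j$ belongs to a continuous eigensystem, then either $\mu$ is constant on $[0,\infty)$ or $\theta$ can be taken strictly increasing. (d) If $k=1$, $x_1\in S_\lambda^U$, $\mu(t)$ is an eigenvalue of $UV(t)$ for all $t\ge0$, and $\mu(t)\to\lambda=\mu(0)$ as $t\to0$, then $\mu(t)\approx\lambda\exp\left(it\,w(x_1)\right)$. (e) Let $I\in\mathbb C^{d\times k}$ be an isometry whose columns are eigenvectors of $U$ for $\lambda$, let $Q=I^\dagger D_+I$, and let $q_1\le\dots\le q_k$ be the eigenvalues of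 $Q$ with multiplicity. For every continuous labelling, exactly $k$ of the functions tend to $\lambda$ as $t\to0$, and these can be indexed as $\lambda_1,\dots,\lambda_k$ so that $\lambda_j(t)\approx\lambda\exp(iq_jt)$ for $j=1,\dots,k$. For every continuous eigensystem this can be done so that in addition $x_j(0)=Iv_j$ with some $v_j\in S^Q_{q_j}$. Conversely $Iv\in S^U_\lambda$ for all $v\in S^Q_{q_j}$. (f) For every continuous eigensystem, every $j=1,\dots,d$ and every $t\ge0$, $\lambda_j$ is differentiable at $t$ (from the right if $t=0$), with $$\lambda_j'(t)=i\lambda_j(t)\sum_{i=1}^d p_i|\langle i|x_j(t)\rangle|^2,\qquad \sum_{j=1}^d|\lambda_j'(t)|=1.$$ For every continuous labelling and every $t\ge0$, the right derivatives of all $\lambda_j$ at $t$ exist, and they satisfy the same two identities with a suitable orthonormal basis $x_1(t),\dots,x_d(t)$ with $UV(t)x_j(t)=\lambda_j(t)x_j(t)$. -/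

import Mathlib

open scoped Matrix Topology

/-- The diagonal matrix `D₊ = ∑ i, p i |i⟩⟨i|`. -/
noncomputable def dPlus {d : ℕ} (p : Fin d → ℝ) : Matrix (Fin d) (Fin d) ℂ :=
  Matrix.diagonal fun i => (p i : ℂ)

/-- The diagonal unitary matrix `V(t) = ∑ i, exp (i p_i t) |i⟩⟨i|`. -/
noncomputable def vMat {d : ℕ} (p : Fin d → ℝ) (t : ℝ) : Matrix (Fin d) (Fin d) ℂ :=
  Matrix.diagonal fun i => Complex.exp (Complex.I * (p i : ℂ) * (t : ℂ))

/-- `V(t) = exp (i t D₊)` as a matrix exponential. -/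
theorem vMat_eq_exp {d : ℕ} (p : Fin d → ℝ) (t : ℝ) :
    vMat p t = NormedSpace.exp ((Complex.I * (t : ℂ)) • dPlus p) := by
  rw [vMat, dPlus, ← Matrix.diagonal_smul, Matrix.exp_diagonal]
  congr 1
  funext i
  rw [Pi.coe_exp, ← Complex.exp_eq_exp_ℂ]
  simp only [Pi.smul_apply, smul_eq_mul]
  congr 1
  ring

/-- `μ` is an eigenvalue of the square matrix `A`. -/
def IsEigval {n : ℕ} (A : Matrix (Fin n) (Fin n) ℂ) (μ : ℂ) : Prop :=
  Module.End.HasEigenvalue (Matrix.toEuclideanLin A) μ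

/-- The multiplicity `r(μ)` of `μ` as an eigenvalue of `A`. -/
noncomputable def eigMult {n : ℕ} (A : Matrix (Fin n) (Fin n) ℂ) (μ : ℂ) : ℕ :=
  A.charpoly.rootMultiplicity μ

/-- `a 0, …, a (n - 1)` are the eigenvalues of `A`, repeated according to multiplicity. -/
def IsEigvalList {n : ℕ} (A : Matrix (Fin n) (Fin n) ℂ) (a : Fin n → ℂ) : Prop :=
  A.charpoly.roots = (Finset.univ : Finset (Fin n)).val.map a

/-- The set `S_μ^A` of Euclidean unit vectors `x` with `A x = μ x`. -/
def unitEigvecs {n : ℕ} (A : Matrix (Fin n) (Fin n) ℂ) (μ : ℂ) :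
    Set (EuclideanSpace ℂ (Fin n)) :=
  {x | Matrix.toEuclideanLin A x = μ • x ∧ ‖x‖ = 1}

/-- The weight `∑ i, p_i |⟨i|x⟩|²`. -/
noncomputable def weight {d : ℕ} (p : Fin d → ℝ) (x : EuclideanSpace ℂ (Fin d)) : ℝ :=
  ∑ i, p i * ‖x i‖ ^ 2

/-- `W` is an isometry whose columns form an orthonormal basis of the `μ`-eigenspace of the
(normal) matrix `A`, `k` being the multiplicity of `μ`. -/
structure IsEigIsometry {d k : ℕ} (A : Matrix (Fin d) (Fin d) ℂ) (μ : ℂ)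
    (W : Matrix (Fin d) (Fin k) ℂ) : Prop where
  card_eq : eigMult A μ = k
  isometry : Wᴴ * W = 1
  eigen : A * W = μ • W

/-- `f(t) ≈ g(t)` for small `t ≥ 0`: equal values and equal (existing) right derivatives at `0`. -/
def ApproxNearZero (f g : ℝ → ℂ) : Prop :=
  f 0 = g 0 ∧ ∃ c : ℂ, HasDerivWithinAt f c (Set.Ici 0) 0 ∧ HasDerivWithinAt g c (Set.Ici 0) 0

/-- A continuous labelling `lam 0 t, …, lam (d - 1) t` of the spectrum of `U V(t)`, `t ≥ 0`. -/
structure IsEigvalCurves {d : ℕ} (U : Matrix (Fin d) (Fin d) ℂ) (p : Fin d → ℝ)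
    (lam : Fin d → ℝ → ℂ) : Prop where
  isEigvalList : ∀ t : ℝ, 0 ≤ t → IsEigvalList (U * vMat p t) fun j => lam j t
  continuousOn : ∀ j, ContinuousOn (lam j) (Set.Ici 0)

/-- Vectors `x j t`, continuous in `t ≥ 0`, that form for each `t ≥ 0` an orthonormal eigenbasis of
`U V(t)` with eigenvalues `lam j t`. -/
structure IsEigSystem {d : ℕ} (U : Matrix (Fin d) (Fin d) ℂ) (p : Fin d → ℝ)
    (lam : Fin d → ℝ → ℂ) (x : Fin d → ℝ → EuclideanSpace ℂ (Fin d)) : Prop where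
  orthonormal : ∀ t : ℝ, 0 ≤ t → Orthonormal ℂ fun j => x j t
  eigen : ∀ t : ℝ, 0 ≤ t → ∀ j, Matrix.toEuclideanLin (U * vMat p t) (x j t) = lam j t • x j t
  continuousOn : ∀ j, ContinuousOn (x j) (Set.Ici 0)

section LocalDiagonalization

set_option linter.unusedSectionVars false

open scoped Matrix.Norms.Operator ContDiff

variable {n : Type*} [Fintype n] [DecidableEq n]

/-- Hermitian matrices whose entries vanish at the positions where `g` takes equal values. -/
def offBlock (g : n → ℝ) : Submodule ℝ (Matrix n n ℂ) where
  carrier := {K | K.IsHermitian ∧ ∀ i j, g i = g j → K i j = 0}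
  add_mem' := fun ha hb => ⟨ha.1.add hb.1, fun i j h => by simp [ha.2 i j h, hb.2 i j h]⟩
  zero_mem' := ⟨Matrix.isHermitian_zero, fun _ _ _ => rfl⟩
  smul_mem' := fun c K hK => ⟨by
    have := hK.1
    unfold Matrix.IsHermitian at *
    rw [Matrix.conjTranspose_smul, this]; simp, fun i j h => by simp [hK.2 i j h]⟩

/-- Twice the projection of the Hermitian part onto `offBlock g`. -/
noncomputable def offProj (g : n → ℝ) : Matrix n n ℂ →ₗ[ℝ] offBlock g where
  toFun M := ⟨Matrix.of fun i j => if g i = g j then 0 else M i j + star (M j i), by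
    constructor
    · ext i j
      by_cases h : g i = g j
      · simp [h]
      · simp [h, Ne.symm h, add_comm]
    · intro i j h
      simp [h]⟩
  map_add' M N := by
    ext i j
    by_cases h : g i = g j
    · simp [h]
    · simp [h]; ring
  map_smul' c M := by
    ext i j
    by_cases h : g i = g j
    · simp [h]
    · simp [h]

theorem offProj_apply (g : n → ℝ) (M : Matrix n n ℂ) (i j : n) :
    (offProj g M : Matrix n n ℂ) i j = if g i = g j then 0 else M i j + star (M j i) := rfl

theorem eq_zero_of_offProj_eq_zero {g : n → ℝ} {M : Matrix n n ℂ} (hM : M.IsHermitian)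
    (h : offProj g M = 0) {i j : n} (hij : g i ≠ g j) : M i j = 0 := by
  have h1 := offProj_apply g M i j
  rw [h, if_neg hij, hM.apply i j] at h1
  have : (0 : ℂ) = M i j + M i j := h1
  linear_combination (-1 / 2 : ℂ) * this

/-- The derivative at `K = 0` of `K ↦ offProj g (exp (-iK) G exp (iK))` for `G = diag g`. -/
noncomputable def offCommutator (g : n → ℝ) : offBlock g →ₗ[ℝ] offBlock g where
  toFun K := offProj g (Matrix.diagonal (fun i => (g i : ℂ)) * (Complex.I • (K : Matrix n n ℂ)) -
    (Complex.I • (K : Matrix n n ℂ)) * Matrix.diagonal (fun i => (g i : ℂ)))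
  map_add' K L := by
    rw [← map_add]
    congr 1
    simp only [Submodule.coe_add, smul_add, mul_add, add_mul]
    abel
  map_smul' c K := by
    rw [RingHom.id_apply, ← map_smul]
    congr 1
    simp only [Submodule.coe_smul, smul_comm Complex.I c, mul_smul_comm, smul_mul_assoc, smul_sub]

theorem offCommutator_injective (g : n → ℝ) : Function.Injective (offCommutator g) := by
  rw [injective_iff_map_eq_zero]
  intro K hK
  ext i j
  by_cases hij : g i = g j
  · rw [K.2.2 i j hij]; rfl
  · have h1 := offProj_apply g (Matrix.diagonal (fun i => (g i : ℂ)) *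
      (Complex.I • (K : Matrix n n ℂ)) -
      (Complex.I • (K : Matrix n n ℂ)) * Matrix.diagonal (fun i => (g i : ℂ))) i j
    have h2 : offProj g (Matrix.diagonal (fun i => (g i : ℂ)) * (Complex.I • (K : Matrix n n ℂ)) -
      (Complex.I • (K : Matrix n n ℂ)) * Matrix.diagonal (fun i => (g i : ℂ))) = 0 := hK
    rw [h2, if_neg hij] at h1
    simp only [Matrix.sub_apply, Matrix.diagonal_mul, Matrix.mul_diagonal, Matrix.smul_apply,
      smul_eq_mul] at h1
    have h3 : star ((K : Matrix n n ℂ) j i) = (K : Matrix n n ℂ) i j := K.2.1.apply i j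
    simp only [Complex.star_def] at h1 h3
    simp only [map_sub, map_mul, Complex.conj_ofReal, Complex.conj_I, h3] at h1
    have h4 : (0 : ℂ) = 2 * Complex.I * ((g i : ℂ) - g j) * (K : Matrix n n ℂ) i j := by
      rw [show (0 : ℂ) = ((0 : offBlock g) : Matrix n n ℂ) i j from rfl, h1]; ring
    have h5 : ((g i : ℂ) - g j) ≠ 0 := by
      rw [sub_ne_zero]; exact_mod_cast hij
    have h6 : 2 * Complex.I * ((g i : ℂ) - g j) ≠ 0 := by
      simp [h5]
    rcases mul_eq_zero.mp h4.symm with h | h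
    · exact absurd h h6
    · exact h

theorem exists_analytic_unitary_offBlock_eq_zero {G : ℝ → Matrix n n ℂ} {t₀ : ℝ} (g : n → ℝ)
    (hG : AnalyticAt ℝ G t₀) (hherm : ∀ᶠ t in 𝓝 t₀, (G t).IsHermitian)
    (h0 : G t₀ = Matrix.diagonal fun i => (g i : ℂ)) :
    ∃ Y : ℝ → Matrix n n ℂ, AnalyticAt ℝ Y t₀ ∧
      ∀ᶠ t in 𝓝 t₀, (Y t)ᴴ * Y t = 1 ∧ ∀ i j, g i ≠ g j → ((Y t)ᴴ * G t * Y t) i j = 0 := by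
  have : CompleteSpace (offBlock g) :=
    (Submodule.complete_of_finiteDimensional (offBlock g)).completeSpace_coe
  let P : Matrix n n ℂ →L[ℝ] offBlock g := LinearMap.toContinuousLinearMap (offProj g)
  let J : offBlock g →L[ℝ] Matrix n n ℂ := LinearMap.toContinuousLinearMap
    { toFun := fun K => Complex.I • (K : Matrix n n ℂ)
      map_add' := fun K L => by simp
      map_smul' := fun c K => by simp [smul_comm Complex.I c] }
  have hJ : ∀ K, J K = Complex.I • (K : Matrix n n ℂ) := fun K => rfl
  let Φ : ℝ × offBlock g → Matrix n n ℂ := fun z =>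
    NormedSpace.exp (-J z.2) * G z.1 * NormedSpace.exp (J z.2)
  let F : ℝ × offBlock g → offBlock g := fun z => P (Φ z)
  have hexp : ∀ x : Matrix n n ℂ, AnalyticAt ℝ NormedSpace.exp x := NormedSpace.exp_analytic
  have hFan : AnalyticAt ℝ F (t₀, 0) := by
    refine (P.analyticAt _).comp (AnalyticAt.mul (AnalyticAt.mul ?_ ?_) ?_)
    · exact AnalyticAt.comp (g := NormedSpace.exp) (hexp _)
        (((J.analyticAt _).comp analyticAt_snd).neg)
    · exact AnalyticAt.comp (g := G) hG analyticAt_fst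
    · exact AnalyticAt.comp (g := NormedSpace.exp) (hexp _)
        ((J.analyticAt _).comp analyticAt_snd)
  have hF : ContDiffAt ℝ ω F (t₀, 0) := hFan.contDiffAt
  have hexp0 : HasFDerivAt (𝕜 := ℝ) (NormedSpace.exp : Matrix n n ℂ → Matrix n n ℂ)
    (1 : Matrix n n ℂ →L[ℝ] Matrix n n ℂ) 0 := hasFDerivAt_exp_zero
  have hder : fderiv ℝ F (t₀, 0) ∘L .inr ℝ ℝ (offBlock g) =
      LinearMap.toContinuousLinearMap (offCommutator g) := by
    have h1 : HasFDerivAt (fun K : offBlock g => F (t₀, K))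
        (fderiv ℝ F (t₀, 0) ∘L .inr ℝ ℝ (offBlock g)) 0 :=
      HasFDerivAt.comp (𝕜 := ℝ) (0 : offBlock g) (g := F)
        (hFan.differentiableAt.hasFDerivAt) (hasFDerivAt_prodMk_right t₀ (0 : offBlock g))
    have e1 : HasFDerivAt (fun K : offBlock g => NormedSpace.exp (J K)) J 0 := by
      have := HasFDerivAt.comp (𝕜 := ℝ) (0 : offBlock g) (g := NormedSpace.exp)
        (g' := 1) (by rw [map_zero]; exact hexp0) J.hasFDerivAt
      exact this
    have e2 : HasFDerivAt (fun K : offBlock g => NormedSpace.exp (-J K)) (-J) 0 := by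
      have := HasFDerivAt.comp (𝕜 := ℝ) (0 : offBlock g) (g := NormedSpace.exp)
        (g' := 1) (f := fun K => -J K) (f' := -J) (by simp only [map_zero, neg_zero]; exact hexp0)
          J.hasFDerivAt.neg
      exact this
    have h2 := P.hasFDerivAt.comp (0 : offBlock g)
      ((e2.mul' (hasFDerivAt_const (G t₀) (0 : offBlock g))).mul' e1)
    have h3 := h1.unique h2
    rw [h3]
    ext1 K
    change offProj g _ = offProj g _
    congr 1
    change NormedSpace.exp (-J 0) * G t₀ * J K +
      (NormedSpace.exp (-J 0) * 0 + -J K * G t₀) * NormedSpace.exp (J 0) = _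
    rw [map_zero, neg_zero, NormedSpace.exp_zero, h0, hJ]
    simp only [one_mul, mul_zero, zero_add, mul_one, neg_mul]
    exact (sub_eq_add_neg _ _).symm
  have hinv : (fderiv ℝ F (t₀, 0) ∘L .inr ℝ ℝ (offBlock g)).IsInvertible := by
    rw [hder]
    refine ⟨(LinearEquiv.ofInjectiveEndo _ (offCommutator_injective g)).toContinuousLinearEquiv, ?_⟩
    ext1 K
    rfl
  have hω : (ω : WithTop ℕ∞) ≠ 0 := WithTop.top_ne_zero
  let K := hF.implicitFunction hω hinv
  have hK : AnalyticAt ℝ K t₀ := (hF.contDiffAt_implicitFunction hω hinv).analyticAt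
  have hKF : ∀ᶠ t in 𝓝 t₀, F (t, K t) = F (t₀, 0) :=
    hF.eventually_apply_implicitFunction hω hinv
  have hF0 : F (t₀, 0) = 0 := by
    change offProj g _ = 0
    ext i j
    rw [offProj_apply]
    simp only [Φ, map_zero, neg_zero, NormedSpace.exp_zero, one_mul, mul_one, h0]
    by_cases h : g i = g j
    · simp [h]
    · have h' : i ≠ j := fun e => h (by rw [e])
      simp [h, h', h'.symm]
  refine ⟨fun t => NormedSpace.exp (J (K t)), ?_, ?_⟩
  · exact AnalyticAt.comp (g := NormedSpace.exp) (hexp _) ((J.analyticAt _).comp hK)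
  · filter_upwards [hKF, hherm] with t ht hHt
    have hstar : (NormedSpace.exp (J (K t)))ᴴ = NormedSpace.exp (-J (K t)) := by
      rw [← Matrix.exp_conjTranspose, hJ, Matrix.conjTranspose_smul, (K t).2.1.eq]
      simp
    have hunit : NormedSpace.exp (-J (K t)) * NormedSpace.exp (J (K t)) = 1 := by
      rw [← Matrix.exp_add_of_commute _ _ (Commute.refl (J (K t))).neg_left, neg_add_cancel,
        NormedSpace.exp_zero]
    refine ⟨by rw [hstar, hunit], fun i j hij => ?_⟩
    refine eq_zero_of_offProj_eq_zero (g := g) ?_ ?_ hij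
    · exact Matrix.isHermitian_conjTranspose_mul_mul _ hHt
    · rw [hstar]
      rw [hF0] at ht
      exact ht

end LocalDiagonalization

section LocalRellich

open scoped Matrix.Norms.Operator ContDiff

set_option linter.unusedSectionVars false

theorem AnalyticAt.realLinearMap_comp {m n F : Type*} [Fintype m] [DecidableEq m]
    [Fintype n] [DecidableEq n]
    [NormedAddCommGroup F] [NormedSpace ℝ F] {H : ℝ → Matrix m n ℂ} {t₀ : ℝ}
    (hH : AnalyticAt ℝ H t₀) (L : Matrix m n ℂ →ₗ[ℝ] F) :
    AnalyticAt ℝ (fun t => L (H t)) t₀ :=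
  ((LinearMap.toContinuousLinearMap L).analyticAt _).comp hH

theorem AnalyticAt.matrix_conjTranspose {n : Type*} [Fintype n] [DecidableEq n]
    {H : ℝ → Matrix n n ℂ} {t₀ : ℝ} (hH : AnalyticAt ℝ H t₀) :
    AnalyticAt ℝ (fun t => (H t)ᴴ) t₀ :=
  hH.realLinearMap_comp
    { toFun := fun M => Mᴴ
      map_add' := fun _ _ => Matrix.conjTranspose_add _ _
      map_smul' := fun c M => by rw [Matrix.conjTranspose_smul]; simp }

theorem AnalyticAt.matrix_trace {n : Type*} [Fintype n] [DecidableEq n]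
    {H : ℝ → Matrix n n ℂ} {t₀ : ℝ} (hH : AnalyticAt ℝ H t₀) :
    AnalyticAt ℝ (fun t => (H t).trace) t₀ :=
  hH.realLinearMap_comp (Matrix.traceLinearMap n ℝ ℂ)

theorem AnalyticAt.matrix_apply {n : Type*} [Fintype n] [DecidableEq n]
    {H : ℝ → Matrix n n ℂ} {t₀ : ℝ} (hH : AnalyticAt ℝ H t₀) (i j : n) :
    AnalyticAt ℝ (fun t => H t i j) t₀ :=
  hH.realLinearMap_comp
    { toFun := fun M => M i j
      map_add' := fun _ _ => rfl
      map_smul' := fun _ _ => rfl }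

theorem AnalyticAt.matrix_submatrix {m n : Type*} [Fintype m] [DecidableEq m]
    [Fintype n] [DecidableEq n]
    {H : ℝ → Matrix n n ℂ} {t₀ : ℝ} (hH : AnalyticAt ℝ H t₀) (e : m → n) :
    AnalyticAt ℝ (fun t => (H t).submatrix e e) t₀ :=
  hH.realLinearMap_comp
    { toFun := fun M => M.submatrix e e
      map_add' := fun _ _ => rfl
      map_smul' := fun _ _ => rfl }

theorem AnalyticAt.matrix_fromBlocks_diag {m n : Type*} [Fintype m] [DecidableEq m]
    [Fintype n] [DecidableEq n]
    {G : ℝ → Matrix m m ℂ} {H : ℝ → Matrix n n ℂ} {t₀ : ℝ} (hG : AnalyticAt ℝ G t₀)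
    (hH : AnalyticAt ℝ H t₀) :
    AnalyticAt ℝ (fun t => Matrix.fromBlocks (G t) 0 0 (H t)) t₀ := by
  have h1 := hG.realLinearMap_comp
    { toFun := fun M => Matrix.fromBlocks M 0 0 (0 : Matrix n n ℂ)
      map_add' := fun _ _ => by simp [Matrix.fromBlocks_add]
      map_smul' := fun c M => by simp [Matrix.fromBlocks_smul] }
  have h2 := hH.realLinearMap_comp
    { toFun := fun M => Matrix.fromBlocks (0 : Matrix m m ℂ) 0 0 M
      map_add' := fun _ _ => by simp [Matrix.fromBlocks_add]
      map_smul' := fun c M => by simp [Matrix.fromBlocks_smul] }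
  refine (h1.add h2).congr (Filter.Eventually.of_forall fun t => ?_)
  simp [Matrix.fromBlocks_add]

/-- Analytic unitary diagonalizability near `t₀` of a family of square matrices. -/
def LocallyDiagonalizable {n : Type*} [Fintype n] [DecidableEq n] (H : ℝ → Matrix n n ℂ)
    (t₀ : ℝ) : Prop :=
  ∃ X : ℝ → Matrix n n ℂ, AnalyticAt ℝ X t₀ ∧
    ∀ᶠ t in 𝓝 t₀, (X t)ᴴ * X t = 1 ∧ ((X t)ᴴ * H t * X t).IsDiag

variable {n : Type*} [Fintype n] [DecidableEq n] {H : ℝ → Matrix n n ℂ} {t₀ : ℝ}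

theorem LocallyDiagonalizable.of_conj {Y : ℝ → Matrix n n ℂ} (hY : AnalyticAt ℝ Y t₀)
    (hYu : ∀ᶠ t in 𝓝 t₀, (Y t)ᴴ * Y t = 1)
    (h : LocallyDiagonalizable (fun t => (Y t)ᴴ * H t * Y t) t₀) : LocallyDiagonalizable H t₀ := by
  obtain ⟨X, hX, hXe⟩ := h
  refine ⟨fun t => Y t * X t, hY.mul hX, ?_⟩
  filter_upwards [hYu, hXe] with t h1 h2
  constructor
  · rw [Matrix.conjTranspose_mul, Matrix.mul_assoc, ← Matrix.mul_assoc (Y t)ᴴ, h1,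
      Matrix.one_mul, h2.1]
  · have := h2.2
    rw [Matrix.conjTranspose_mul]
    simpa only [Matrix.mul_assoc] using this

theorem LocallyDiagonalizable.of_smul_add {G : ℝ → Matrix n n ℂ} {a b : ℝ → ℂ}
    (hH : ∀ᶠ t in 𝓝 t₀, H t = a t • 1 + b t • G t)
    (h : LocallyDiagonalizable G t₀) : LocallyDiagonalizable H t₀ := by
  obtain ⟨X, hX, hXe⟩ := h
  refine ⟨X, hX, ?_⟩
  filter_upwards [hH, hXe] with t h1 h2
  refine ⟨h2.1, ?_⟩
  rw [h1, Matrix.mul_add, Matrix.add_mul]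
  simp only [Matrix.mul_smul, Matrix.smul_mul, Matrix.mul_one, h2.1]
  exact (Matrix.isDiag_one.smul _).add (h2.2.smul _)

theorem LocallyDiagonalizable.of_submatrix {m : Type*} [Fintype m] [DecidableEq m] (e : m ≃ n)
    (h : LocallyDiagonalizable (fun t => (H t).submatrix e e) t₀) :
    LocallyDiagonalizable H t₀ := by
  obtain ⟨X, hX, hXe⟩ := h
  refine ⟨fun t => (X t).submatrix e.symm e.symm, hX.matrix_submatrix _, ?_⟩
  filter_upwards [hXe] with t h2
  constructor
  · rw [Matrix.conjTranspose_submatrix, Matrix.submatrix_mul_equiv, h2.1,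
      Matrix.submatrix_one_equiv]
  · have h3 : H t = ((H t).submatrix e e).submatrix e.symm e.symm := by simp
    rw [Matrix.conjTranspose_submatrix, h3, Matrix.submatrix_mul_equiv,
      Matrix.submatrix_mul_equiv]
    exact h2.2.submatrix e.symm.injective

theorem LocallyDiagonalizable.fromBlocks {m : Type*} [Fintype m] [DecidableEq m]
    {G : ℝ → Matrix m m ℂ} (hG : LocallyDiagonalizable G t₀) (hH : LocallyDiagonalizable H t₀) :
    LocallyDiagonalizable (fun t => Matrix.fromBlocks (G t) 0 0 (H t)) t₀ := by
  obtain ⟨X, hX, hXe⟩ := hG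
  obtain ⟨Y, hY, hYe⟩ := hH
  refine ⟨fun t => Matrix.fromBlocks (X t) 0 0 (Y t), hX.matrix_fromBlocks_diag hY, ?_⟩
  filter_upwards [hXe, hYe] with t h1 h2
  rw [Matrix.fromBlocks_conjTranspose]
  simp only [Matrix.fromBlocks_multiply, Matrix.conjTranspose_zero, Matrix.mul_zero,
    Matrix.zero_mul, add_zero, zero_add, h1.1, h2.1, Matrix.fromBlocks_one, true_and]
  exact h1.2.fromBlocks h2.2

theorem LocallyDiagonalizable.congr {G : ℝ → Matrix n n ℂ} (h : LocallyDiagonalizable G t₀)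
    (e : ∀ᶠ t in 𝓝 t₀, H t = G t) : LocallyDiagonalizable H t₀ := by
  obtain ⟨X, hX, hXe⟩ := h
  refine ⟨X, hX, ?_⟩
  filter_upwards [hXe, e] with t h1 h2
  rwa [h2]

theorem Matrix.IsHermitian.exists_unitary_diagonal {A : Matrix n n ℂ} (hA : A.IsHermitian) :
    ∃ (W : Matrix n n ℂ) (g : n → ℝ), Wᴴ * W = 1 ∧ W * Wᴴ = 1 ∧
      Wᴴ * A * W = Matrix.diagonal fun i => (g i : ℂ) := by
  have h1 : (hA.eigenvectorUnitary : Matrix n n ℂ)ᴴ * hA.eigenvectorUnitary = 1 :=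
    (Matrix.mem_unitaryGroup_iff').mp hA.eigenvectorUnitary.2
  refine ⟨hA.eigenvectorUnitary, hA.eigenvalues, h1, mul_eq_one_comm.mp h1, ?_⟩
  have h2 := hA.spectral_theorem
  rw [Unitary.conjStarAlgAut_apply] at h2
  generalize (hA.eigenvectorUnitary : Matrix n n ℂ) = W at h1 h2 ⊢
  generalize hA.eigenvalues = g at h2 ⊢
  rw [h2, Matrix.star_eq_conjTranspose]
  simp only [Matrix.mul_assoc, h1, Matrix.mul_one]
  rw [← Matrix.mul_assoc, h1, Matrix.one_mul]
  rfl

/-- A Hermitian analytic family is locally either scalar, or up to scalar families analytic with a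
trace-free nonzero value at `t₀`. -/
theorem exists_traceless_germ (hH : AnalyticAt ℝ H t₀) (hherm : ∀ᶠ t in 𝓝 t₀, (H t).IsHermitian) :
    (∀ᶠ t in 𝓝 t₀, ∃ a : ℂ, H t = a • 1) ∨
    ∃ (G : ℝ → Matrix n n ℂ) (a b : ℝ → ℂ), AnalyticAt ℝ G t₀ ∧
      (∀ᶠ t in 𝓝 t₀, (G t).IsHermitian) ∧ G t₀ ≠ 0 ∧ (G t₀).trace = 0 ∧
      ∀ᶠ t in 𝓝 t₀, H t = a t • 1 + b t • G t := by
  let a : ℝ → ℂ := fun t => (H t).trace / Fintype.card n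
  let F : ℝ → Matrix n n ℂ := fun t => H t - a t • 1
  have ha : AnalyticAt ℝ a t₀ := hH.matrix_trace.div_const
  have hF : AnalyticAt ℝ F t₀ := hH.sub (ha.smul analyticAt_const)
  by_cases hz : ∀ᶠ t in 𝓝 t₀, F t = 0
  · left
    filter_upwards [hz] with t ht
    exact ⟨a t, sub_eq_zero.mp ht⟩
  right
  obtain ⟨m, G, hG, hG0, hFG⟩ := hF.exists_eventuallyEq_pow_smul_nonzero_iff.mpr hz
  have hne : Nonempty n := by
    by_contra h
    rw [not_nonempty_iff] at h
    exact hG0 (Subsingleton.elim _ _)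
  have hcard : (Fintype.card n : ℂ) ≠ 0 := by
    exact_mod_cast Fintype.card_ne_zero
  have hFtr : ∀ t, (F t).trace = 0 := fun t => by
    simp only [F, a, Matrix.trace_sub, Matrix.trace_smul, Matrix.trace_one, smul_eq_mul]
    rw [div_mul_cancel₀ _ hcard, sub_self]
  have hFherm : ∀ᶠ t in 𝓝 t₀, (F t).IsHermitian := by
    filter_upwards [hherm] with t ht
    refine ht.sub ?_
    have htr : star (a t) = a t := by
      simp only [a, star_div₀, ← Matrix.trace_conjTranspose, ht.eq, star_natCast]
    unfold Matrix.IsHermitian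
    rw [Matrix.conjTranspose_smul, htr, Matrix.conjTranspose_one]
  have hpow : ∀ t : ℝ, t ≠ t₀ → (t - t₀) ^ m ≠ 0 := fun t ht =>
    pow_ne_zero _ (sub_ne_zero.mpr ht)
  have hGeq : ∀ᶠ t in 𝓝[≠] t₀, G t = ((t - t₀) ^ m)⁻¹ • F t := by
    filter_upwards [hFG.filter_mono nhdsWithin_le_nhds, self_mem_nhdsWithin] with t ht htne
    rw [ht, inv_smul_smul₀ (hpow t htne)]
  have hGtr : (G t₀).trace = 0 := by
    have h1 : Filter.Tendsto (fun t => (G t).trace) (𝓝[≠] t₀) (𝓝 (G t₀).trace) :=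
      hG.matrix_trace.continuousAt.tendsto.mono_left nhdsWithin_le_nhds
    refine tendsto_nhds_unique h1 (tendsto_const_nhds.congr' ?_)
    filter_upwards [hGeq] with t ht
    rw [ht, Matrix.trace_smul, hFtr, smul_zero]
  have hGherm' : ∀ᶠ t in 𝓝[≠] t₀, (G t).IsHermitian := by
    filter_upwards [hGeq, hFherm.filter_mono nhdsWithin_le_nhds] with t ht hh
    rw [ht]
    unfold Matrix.IsHermitian
    rw [Matrix.conjTranspose_smul, hh.eq]
    simp
  have hGherm0 : (G t₀).IsHermitian := by
    have h1 : Filter.Tendsto (fun t => (G t)ᴴ) (𝓝[≠] t₀) (𝓝 (G t₀)ᴴ) :=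
      hG.matrix_conjTranspose.continuousAt.tendsto.mono_left nhdsWithin_le_nhds
    have h2 : Filter.Tendsto G (𝓝[≠] t₀) (𝓝 (G t₀)) :=
      hG.continuousAt.tendsto.mono_left nhdsWithin_le_nhds
    exact tendsto_nhds_unique h1 (h2.congr' (hGherm'.mono fun t ht => ht.eq.symm))
  refine ⟨G, a, fun t => (((t - t₀) ^ m : ℝ) : ℂ), hG, ?_, hG0, hGtr, ?_⟩
  · have := eventually_nhdsWithin_iff.mp hGherm'
    filter_upwards [this] with t ht
    by_cases h : t = t₀
    · rw [h]; exact hGherm0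
    · exact ht h
  · filter_upwards [hFG] with t ht
    have : H t = a t • 1 + F t := by simp [F]
    rw [this, ht]
    congr 1

/-- **Rellich's theorem** (local form). -/
theorem locallyDiagonalizable_of_isHermitian (N : ℕ) : ∀ (n : Type) [Fintype n] [DecidableEq n]
    (H : ℝ → Matrix n n ℂ) (t₀ : ℝ), Fintype.card n = N → AnalyticAt ℝ H t₀ →
    (∀ᶠ t in 𝓝 t₀, (H t).IsHermitian) → LocallyDiagonalizable H t₀ := by
  induction N using Nat.strong_induction_on with
  | _ N ih =>
  intro n _ _ H t₀ hN hH hherm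
  rcases exists_traceless_germ hH hherm with h | ⟨G, a, b, hG, hGh, hG0, hGtr, hHG⟩
  · refine ⟨fun _ => 1, analyticAt_const, ?_⟩
    filter_upwards [h] with t ⟨a, ht⟩
    rw [ht]
    simp
  refine LocallyDiagonalizable.of_smul_add hHG ?_
  obtain ⟨W, g, hW, hW', hWG⟩ := hGh.self_of_nhds.exists_unitary_diagonal
  have hG1 : AnalyticAt ℝ (fun t => Wᴴ * G t * W) t₀ :=
    (analyticAt_const.mul hG).mul analyticAt_const
  have hGh1 : ∀ᶠ t in 𝓝 t₀, (Wᴴ * G t * W).IsHermitian :=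
    hGh.mono fun t ht => Matrix.isHermitian_conjTranspose_mul_mul _ ht
  obtain ⟨Y, hY, hYe⟩ := exists_analytic_unitary_offBlock_eq_zero g hG1 hGh1 hWG
  have hnonempty : Nonempty n := by
    by_contra h
    rw [not_nonempty_iff] at h
    exact hG0 (Subsingleton.elim _ _)
  obtain ⟨i₀⟩ := hnonempty
  have hex : ∃ i₁, g i₁ ≠ g i₀ := by
    by_contra! hcon
    have hd : (Matrix.diagonal fun i => (g i : ℂ)) = (g i₀ : ℂ) • (1 : Matrix n n ℂ) := by
      rw [Matrix.smul_one_eq_diagonal]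
      congr 1
      funext i
      rw [hcon i]
    have htr : (Wᴴ * G t₀ * W).trace = 0 := by
      rw [Matrix.trace_mul_cycle, hW', Matrix.one_mul, hGtr]
    rw [hWG, hd, Matrix.trace_smul, Matrix.trace_one, smul_eq_mul, mul_eq_zero] at htr
    have : Nonempty n := ⟨i₀⟩
    have hg0 : (g i₀ : ℂ) = 0 := htr.resolve_right (by exact_mod_cast Fintype.card_ne_zero)
    rw [hd, hg0, zero_smul] at hWG
    apply hG0
    have : G t₀ = W * (Wᴴ * G t₀ * W) * Wᴴ := by
      simp only [Matrix.mul_assoc, hW', Matrix.mul_one]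
      rw [← Matrix.mul_assoc, hW', Matrix.one_mul]
    rw [this, hWG]
    simp
  obtain ⟨i₁, hi₁⟩ := hex
  refine LocallyDiagonalizable.of_conj (Y := fun _ => W) analyticAt_const
    (Filter.Eventually.of_forall fun _ => hW) ?_
  refine LocallyDiagonalizable.of_conj (Y := Y) hY (hYe.mono fun t ht => ht.1) ?_
  refine LocallyDiagonalizable.of_submatrix (Equiv.sumCompl fun i => g i = g i₀) ?_
  have hM : AnalyticAt ℝ (fun t => (Y t)ᴴ * (Wᴴ * G t * W) * Y t) t₀ :=
    (hY.matrix_conjTranspose.mul hG1).mul hY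
  have hMh : ∀ᶠ t in 𝓝 t₀, ((Y t)ᴴ * (Wᴴ * G t * W) * Y t).IsHermitian :=
    hGh1.mono fun t ht => Matrix.isHermitian_conjTranspose_mul_mul _ ht
  have c1 : Fintype.card {i // g i = g i₀} < N := by
    rw [← hN]
    exact Fintype.card_subtype_lt (x := i₁) hi₁
  have c2 : Fintype.card {i // ¬ g i = g i₀} < N := by
    rw [← hN]
    exact Fintype.card_subtype_lt (x := i₀) (by simp)
  have h1 := ih _ c1 _ _ t₀ rfl (hM.matrix_submatrix (Subtype.val : {i // g i = g i₀} → n))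
    (hMh.mono fun t ht => ht.submatrix _)
  have h2 := ih _ c2 _ _ t₀ rfl (hM.matrix_submatrix (Subtype.val : {i // ¬ g i = g i₀} → n))
    (hMh.mono fun t ht => ht.submatrix _)
  refine (h1.fromBlocks h2).congr ?_
  filter_upwards [hYe] with t ht
  ext (i | i) (j | j)
  · rfl
  · exact ht.2 i j (fun h => j.2 (h.symm.trans i.2))
  · exact ht.2 i j (fun h => i.2 (h.trans j.2))
  · rfl

end LocalRellich

section Frames

open scoped Matrix.Norms.Operator

variable {n : Type*} [Fintype n] [DecidableEq n] {A X : ℝ → Matrix n n ℂ}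

/-- The columns of `X` form an orthonormal eigenbasis of `A`. -/
def IsEigenframe (A X : Matrix n n ℂ) : Prop :=
  Xᴴ * X = 1 ∧ (Xᴴ * A * X).IsDiag

theorem LocallyDiagonalizable.exists_ball {t₀ : ℝ} (hA : AnalyticAt ℝ A t₀)
    (h : LocallyDiagonalizable A t₀) :
    ∃ ε > 0, ∃ X : ℝ → Matrix n n ℂ, ContinuousOn X (Metric.ball t₀ ε) ∧
      (∀ t ∈ Metric.ball t₀ ε, IsEigenframe (A t) (X t)) ∧
      ∀ s ∈ Metric.ball t₀ ε, s ≠ t₀ → ∀ i j, ((X s)ᴴ * A s * X s) i i = ((X s)ᴴ * A s * X s) j j →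
        ∀ t ∈ Metric.ball t₀ ε, ((X t)ᴴ * A t * X t) i i = ((X t)ᴴ * A t * X t) j j := by
  obtain ⟨X, hX, hXe⟩ := h
  have hM : AnalyticAt ℝ (fun t => (X t)ᴴ * A t * X t) t₀ :=
    (hX.matrix_conjTranspose.mul hA).mul hX
  have hdich : ∀ᶠ t in 𝓝 t₀, ∀ i j,
      (∀ᶠ s in 𝓝 t₀, ((X s)ᴴ * A s * X s) i i = ((X s)ᴴ * A s * X s) j j) ∨
      (t ≠ t₀ → ((X t)ᴴ * A t * X t) i i ≠ ((X t)ᴴ * A t * X t) j j) := by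
    rw [Filter.eventually_all]
    intro i
    rw [Filter.eventually_all]
    intro j
    rcases ((hM.matrix_apply i i).sub (hM.matrix_apply j j)).eventually_eq_zero_or_eventually_ne_zero
      with h | h
    · exact Filter.Eventually.of_forall fun t => Or.inl (h.mono fun s hs => sub_eq_zero.mp hs)
    · rw [eventually_nhdsWithin_iff] at h
      filter_upwards [h] with t ht
      exact Or.inr fun hne => sub_ne_zero.mp (ht hne)
  have hsame : ∀ᶠ t in 𝓝 t₀, ∀ i j,
      (∀ᶠ s in 𝓝 t₀, ((X s)ᴴ * A s * X s) i i = ((X s)ᴴ * A s * X s) j j) →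
      ((X t)ᴴ * A t * X t) i i = ((X t)ᴴ * A t * X t) j j := by
    rw [Filter.eventually_all]
    intro i
    rw [Filter.eventually_all]
    intro j
    by_cases h : ∀ᶠ s in 𝓝 t₀, ((X s)ᴴ * A s * X s) i i = ((X s)ᴴ * A s * X s) j j
    · exact h.mono fun t ht _ => ht
    · exact Filter.Eventually.of_forall fun t h' => absurd h' h
  obtain ⟨ε, hε, hball⟩ := Metric.eventually_nhds_iff_ball.mp
    (((hX.eventually_analyticAt.and hXe).and hdich).and hsame)
  refine ⟨ε, hε, X, fun t ht => (hball t ht).1.1.1.continuousAt.continuousWithinAt,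
    fun t ht => (hball t ht).1.1.2, fun s hs hne i j hij t ht => ?_⟩
  refine (hball t ht).2 i j ?_
  rcases (hball s hs).1.2 i j with h | h
  · exact h
  · exact absurd hij (h hne)

theorem IsEigenframe.mul_eq {A X : Matrix n n ℂ} (h : IsEigenframe A X) :
    A * X = X * Matrix.diagonal (Matrix.diag (Xᴴ * A * X)) := by
  rw [h.2.diagonal_diag, ← Matrix.mul_assoc, ← Matrix.mul_assoc, mul_eq_one_comm.mp h.1,
    Matrix.one_mul]

theorem IsEigenframe.of_mul_eq {A X : Matrix n n ℂ} {a : n → ℂ} (h1 : Xᴴ * X = 1)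
    (h : A * X = X * Matrix.diagonal a) : IsEigenframe A X :=
  ⟨h1, by rw [Matrix.mul_assoc, h, ← Matrix.mul_assoc, h1, Matrix.one_mul]
          exact Matrix.isDiag_diagonal _⟩

/-- A frame prescribed at a point `s` where eigenvalues coincide only if they coincide on all of
`J` extends to `J`. -/
theorem exists_frame_through {J : Set ℝ} (hX : ContinuousOn X J)
    (hfr : ∀ t ∈ J, IsEigenframe (A t) (X t)) {s : ℝ} (hs : s ∈ J)
    (hgen : ∀ i j, ((X s)ᴴ * A s * X s) i i = ((X s)ᴴ * A s * X s) j j →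
        ∀ t ∈ J, ((X t)ᴴ * A t * X t) i i = ((X t)ᴴ * A t * X t) j j)
    {Z : Matrix n n ℂ} (hZ : IsEigenframe (A s) Z) :
    ∃ Y : ℝ → Matrix n n ℂ, ContinuousOn Y J ∧ (∀ t ∈ J, IsEigenframe (A t) (Y t)) ∧ Y s = Z := by
  let C := (X s)ᴴ * Z
  have hXs := mul_eq_one_comm.mp (hfr s hs).1
  have hC : Cᴴ * C = 1 := by
    simp only [C, Matrix.conjTranspose_mul, Matrix.conjTranspose_conjTranspose]
    rw [Matrix.mul_assoc, ← Matrix.mul_assoc (X s), hXs, Matrix.one_mul, hZ.1]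
  have hint : Matrix.diagonal (Matrix.diag ((X s)ᴴ * A s * X s)) * C =
      C * Matrix.diagonal (Matrix.diag (Zᴴ * A s * Z)) := by
    rw [(hfr s hs).2.diagonal_diag]
    simp only [C]
    rw [Matrix.mul_assoc _ Z, ← hZ.mul_eq]
    simp only [Matrix.mul_assoc]
    rw [← Matrix.mul_assoc (X s), hXs, Matrix.one_mul]
  have hcol : ∀ k, ∃ i, C i k ≠ 0 := by
    intro k
    by_contra! hcon
    have h1 := congrFun (congrFun hC k) k
    rw [Matrix.mul_apply, Matrix.one_apply_eq] at h1
    simp [hcon] at h1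
  choose f hf using hcol
  have hentry : ∀ i k, C i k ≠ 0 →
      ((X s)ᴴ * A s * X s) i i = (Zᴴ * A s * Z) k k := by
    intro i k hik
    have h1 := congrFun (congrFun hint i) k
    rw [Matrix.diagonal_mul, Matrix.mul_diagonal, mul_comm] at h1
    exact mul_left_cancel₀ hik h1
  refine ⟨fun t => X t * C, hX.mul continuousOn_const, fun t ht => ?_, ?_⟩
  · refine IsEigenframe.of_mul_eq (a := fun k => ((X t)ᴴ * A t * X t) (f k) (f k)) ?_ ?_
    · rw [Matrix.conjTranspose_mul, Matrix.mul_assoc, ← Matrix.mul_assoc (X t)ᴴ, (hfr t ht).1,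
        Matrix.one_mul, hC]
    · change A t * (X t * C) = X t * C * _
      rw [← Matrix.mul_assoc, (hfr t ht).mul_eq, Matrix.mul_assoc (X t) _ C,
        Matrix.mul_assoc (X t) C]
      congr 1
      ext i k
      rw [Matrix.diagonal_mul, Matrix.mul_diagonal, mul_comm]
      by_cases h : C i k = 0
      · simp [h]
      · congr 1
        exact hgen i (f k) ((hentry i k h).trans (hentry _ k (hf k)).symm) t ht
  · simp only [C]
    rw [← Matrix.mul_assoc, hXs, Matrix.one_mul]

/-- Every eigenframe of `A a` extends to a continuous eigenframe on `[a, b]`. -/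
def FrameExtends (A : ℝ → Matrix n n ℂ) (a b : ℝ) : Prop :=
  ∀ Z, IsEigenframe (A a) Z → ∃ X : ℝ → Matrix n n ℂ, ContinuousOn X (Set.Icc a b) ∧
    (∀ t ∈ Set.Icc a b, IsEigenframe (A t) (X t)) ∧ X a = Z

theorem exists_frame_glue {a b c : ℝ} (hab : a ≤ b) (hbc : b ≤ c)
    (hX : ContinuousOn X (Set.Icc a b)) (hXf : ∀ t ∈ Set.Icc a b, IsEigenframe (A t) (X t))
    (h : FrameExtends A b c) :
    ∃ Y : ℝ → Matrix n n ℂ, ContinuousOn Y (Set.Icc a c) ∧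
      (∀ t ∈ Set.Icc a c, IsEigenframe (A t) (Y t)) ∧ Set.EqOn Y X (Set.Icc a b) := by
  obtain ⟨X', hX', hXf', hb⟩ := h (X b) (hXf b ⟨hab, le_rfl⟩)
  have e1 : Set.EqOn (fun t => if t ≤ b then X t else X' t) X (Set.Icc a b) :=
    fun t ht => if_pos ht.2
  have e2 : Set.EqOn (fun t => if t ≤ b then X t else X' t) X' (Set.Icc b c) := by
    intro t ht
    rcases ht.1.eq_or_lt with h | h
    · subst h
      simp [hb]
    · exact if_neg (not_le.mpr h)
  refine ⟨fun t => if t ≤ b then X t else X' t, ?_, fun t ht => ?_, e1⟩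
  · rw [← Set.Icc_union_Icc_eq_Icc hab hbc]
    exact (hX.congr e1).union_of_isClosed (hX'.congr e2) isClosed_Icc isClosed_Icc
  · rcases le_total t b with h | h
    · have := e1 ⟨ht.1, h⟩
      simp only at this ⊢
      rw [this]; exact hXf t ⟨ht.1, h⟩
    · have := e2 ⟨h, ht.2⟩
      simp only at this ⊢
      rw [this]; exact hXf' t ⟨h, ht.2⟩

theorem FrameExtends.trans {a b c : ℝ} (hab : a ≤ b) (hbc : b ≤ c) (h1 : FrameExtends A a b)
    (h2 : FrameExtends A b c) : FrameExtends A a c := by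
  intro Z hZ
  obtain ⟨X, hX, hXf, ha⟩ := h1 Z hZ
  obtain ⟨Y, hY, hYf, hYX⟩ := exists_frame_glue hab hbc hX hXf h2
  exact ⟨Y, hY, hYf, by rw [hYX ⟨le_rfl, hab⟩, ha]⟩

/-- If every point has a neighbourhood on which frames extend from all points outside `B`, then
frames extend arbitrarily far from all points outside `B`. -/
theorem frameExtends_of_local {B : Set ℝ} (hB : Dense Bᶜ)
    (hloc : ∀ t₀ : ℝ, ∃ ε > 0, ∀ s ∈ Metric.ball t₀ ε, s ∉ B → ∀ b ∈ Metric.ball t₀ ε, s ≤ b →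
      FrameExtends A s b) {a b : ℝ} (ha : a ∉ B) (hab : a ≤ b) : FrameExtends A a b := by
  by_contra hcon
  let T : Set ℝ := {b | a ≤ b ∧ ¬ FrameExtends A a b}
  have hTne : T.Nonempty := ⟨b, hab, hcon⟩
  have hTbdd : BddBelow T := ⟨a, fun x hx => hx.1⟩
  have hac : a ≤ sInf T := le_csInf hTne fun x hx => hx.1
  obtain ⟨ε, hε, hJ⟩ := hloc (sInf T)
  obtain ⟨s, hs, hsB, has, hsF⟩ : ∃ s ∈ Metric.ball (sInf T) ε, s ∉ B ∧ (a ≤ s ∧ s ≤ sInf T) ∧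
      (s = a ∨ FrameExtends A a s) := by
    rcases hac.eq_or_lt with h | h
    · exact ⟨a, by rw [← h]; exact Metric.mem_ball_self hε, ha, ⟨le_rfl, hac⟩, Or.inl rfl⟩
    · obtain ⟨s, hsB, hs⟩ := hB.exists_mem_open (isOpen_Ioo (a := max a (sInf T - ε)) (b := sInf T))
        (Set.nonempty_Ioo.mpr (max_lt h (by linarith)))
      have h1 := lt_of_le_of_lt (le_max_left _ _) hs.1
      have h2 := lt_of_le_of_lt (le_max_right _ _) hs.1
      refine ⟨s, ?_, hsB, ⟨h1.le, hs.2.le⟩, Or.inr ?_⟩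
      · rw [Metric.mem_ball, Real.dist_eq, abs_lt]
        constructor <;> linarith [hs.2]
      · by_contra hF
        exact absurd (csInf_le hTbdd (show s ∈ T from ⟨h1.le, hF⟩)) (not_le.mpr hs.2)
  obtain ⟨c, hcT, hc⟩ := exists_lt_of_csInf_lt hTne (show sInf T < sInf T + ε by linarith)
  have hc' : sInf T ≤ c := csInf_le hTbdd hcT
  have hcJ : c ∈ Metric.ball (sInf T) ε := by
    rw [Metric.mem_ball, Real.dist_eq, abs_lt]
    constructor <;> linarith
  have hext := hJ s hs hsB c hcJ (has.2.trans hc')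
  refine hcT.2 ?_
  rcases hsF with h | h
  · rwa [h] at hext
  · exact h.trans has.1 (has.2.trans hc') hext

/-- A locally analytically unitarily diagonalizable family has a continuous eigenframe on
`[0, ∞)`. -/
theorem exists_continuousOn_eigenframe (hA : ∀ t, AnalyticAt ℝ A t)
    (hdiag : ∀ t, LocallyDiagonalizable A t) :
    ∃ X : ℝ → Matrix n n ℂ, ContinuousOn X (Set.Ici 0) ∧
      ∀ t, 0 ≤ t → IsEigenframe (A t) (X t) := by
  choose ε hε X hXc hXf hXg using fun t => (hdiag t).exists_ball (hA t)
  obtain ⟨B, hBc, hBcov⟩ := TopologicalSpace.countable_cover_nhds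
    (f := fun t => Metric.ball t (ε t)) fun t => Metric.ball_mem_nhds t (hε t)
  have hBd : Dense Bᶜ := hBc.dense_compl ℝ
  have hcov : ∀ t : ℝ, ∃ r ∈ B, t ∈ Metric.ball r (ε r) := fun t => by
    have : t ∈ ⋃ x ∈ B, Metric.ball x (ε x) := by rw [hBcov]; trivial
    simpa using this
  have hloc : ∀ t₀ : ℝ, ∃ δ > 0, ∀ s ∈ Metric.ball t₀ δ, s ∉ B → ∀ b ∈ Metric.ball t₀ δ, s ≤ b →
      FrameExtends A s b := by
    intro t₀
    obtain ⟨r, hr, htr⟩ := hcov t₀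
    obtain ⟨δ, hδ, hsub⟩ := Metric.isOpen_ball.mem_nhds htr |> Metric.mem_nhds_iff.mp
    refine ⟨δ, hδ, fun s hs hsB b hb _ Z hZ => ?_⟩
    obtain ⟨Y, hY, hYf, hYs⟩ := exists_frame_through (hXc r) (hXf r) (hsub hs)
      (hXg r s (hsub hs) (fun h => hsB (h ▸ hr))) hZ
    have hIcc : Set.Icc s b ⊆ Metric.ball r (ε r) := by
      have hoc : (Metric.ball r (ε r)).OrdConnected := (convex_ball r (ε r)).ordConnected
      exact hoc.out (hsub hs) (hsub hb)
    exact ⟨Y, hY.mono hIcc, fun t ht => hYf t (hIcc ht), hYs⟩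
  have hext : ∀ {a b : ℝ}, a ∉ B → a ≤ b → FrameExtends A a b := fun ha hab =>
    frameExtends_of_local hBd hloc ha hab
  obtain ⟨r, hr, h0r⟩ := hcov 0
  obtain ⟨δ, hδ, hδr⟩ := Metric.isOpen_ball.mem_nhds h0r |> Metric.mem_nhds_iff.mp
  have hs : ∀ k : ℕ, ∃ s : ℝ, s ∉ B ∧ s ∈ Set.Ioo (k : ℝ) (k + min δ 1) := fun k =>
    hBd.exists_mem_open isOpen_Ioo (Set.nonempty_Ioo.mpr (by
      have : 0 < min δ 1 := lt_min hδ one_pos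
      linarith))
  choose s hsB hsI using hs
  have hsmono : ∀ k, s k ≤ s (k + 1) := fun k => by
    have h1 := (hsI k).2
    have h2 := (hsI (k + 1)).1
    have h3 := min_le_right δ 1
    push_cast at h2
    linarith
  have hspos : ∀ k, 0 ≤ s k := fun k => by
    have h1 := (hsI k).1
    have h2 : (0 : ℝ) ≤ k := Nat.cast_nonneg k
    linarith
  let P : ℕ → (ℝ → Matrix n n ℂ) → Prop := fun k Y =>
    ContinuousOn Y (Set.Icc 0 (s k)) ∧ ∀ t ∈ Set.Icc 0 (s k), IsEigenframe (A t) (Y t)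
  have hbase : ∃ Y, P 0 Y := by
    have hsub : Set.Icc 0 (s 0) ⊆ Metric.ball r (ε r) := by
      refine Set.Subset.trans (fun t ht => ?_) hδr
      have h1 := (hsI 0).2
      have h3 := min_le_left δ 1
      rw [Metric.mem_ball, Real.dist_eq, abs_lt]
      simp only [Nat.cast_zero, zero_add] at h1
      constructor <;> linarith [ht.1, ht.2]
    exact ⟨X r, (hXc r).mono hsub, fun t ht => hXf r t (hsub ht)⟩
  have hstep : ∀ k Y, P k Y → ∃ Y', P (k + 1) Y' ∧ Set.EqOn Y' Y (Set.Icc 0 (s k)) := by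
    intro k Y hY
    obtain ⟨Y', h1, h2, h3⟩ := exists_frame_glue (hspos k) (hsmono k) hY.1 hY.2
      (hext (hsB k) (hsmono k))
    exact ⟨Y', ⟨h1, h2⟩, h3⟩
  choose! step hstepP hstepE using hstep
  obtain ⟨Y₀, hY₀⟩ := hbase
  let Y : ℕ → ℝ → Matrix n n ℂ := fun k => Nat.rec Y₀ (fun k Z => step k Z) k
  have hYP : ∀ k, P k (Y k) := fun k => by
    induction k with
    | zero => exact hY₀
    | succ k ih => exact hstepP k _ ih
  have hsm : Monotone s := monotone_nat_of_le_succ hsmono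
  have hYE : ∀ k m, k ≤ m → Set.EqOn (Y m) (Y k) (Set.Icc 0 (s k)) := by
    intro k m hkm
    induction m, hkm using Nat.le_induction with
    | base => exact fun _ _ => rfl
    | succ m hm ih =>
      intro t ht
      rw [← ih ht]
      exact hstepE m _ (hYP m) ⟨ht.1, ht.2.trans (hsm hm)⟩
  have hXY : ∀ k : ℕ, Set.EqOn (fun t => Y ⌈t⌉₊ t) (Y k) (Set.Icc 0 k) := by
    intro k t ht
    have h1 : ⌈t⌉₊ ≤ k := Nat.ceil_le.mpr ht.2
    exact (hYE _ k h1 ⟨ht.1, (Nat.le_ceil t).trans (hsI _).1.le⟩).symm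
  refine ⟨fun t => Y ⌈t⌉₊ t, fun t ht => ?_, fun t ht => ?_⟩
  · obtain ⟨k, hk⟩ := exists_nat_gt t
    have h1 : ContinuousOn (fun t => Y ⌈t⌉₊ t) (Set.Icc 0 (k : ℝ)) :=
      ((hYP k).1.mono (Set.Icc_subset_Icc le_rfl (hsI k).1.le)).congr (hXY k)
    refine (h1 t ⟨ht, hk.le⟩).mono_of_mem_nhdsWithin ?_
    rw [← Set.Ici_inter_Iic]
    exact Filter.inter_mem self_mem_nhdsWithin (mem_nhdsWithin_of_mem_nhds (Iic_mem_nhds hk))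
  · exact (hYP _).2 t ⟨ht, (Nat.le_ceil t).trans (hsI _).1.le⟩

end Frames

section CayleyTransform

open scoped Matrix.Norms.Operator

theorem Matrix.exists_norm_one_isUnit_smul_sub {n : Type*} [Fintype n] [DecidableEq n]
    (A : Matrix n n ℂ) : ∃ ω : ℂ, ‖ω‖ = 1 ∧ IsUnit (ω • (1 : Matrix n n ℂ) - A) := by
  have hinf : (Metric.sphere (0 : ℂ) 1).Infinite := by
    refine IsPreconnected.infinite_of_nontrivial
      (isPreconnected_sphere (by rw [Complex.rank_real_complex]; exact Cardinal.one_lt_two) 0 1) ?_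
    exact ⟨1, by simp, -1, by simp, by norm_num⟩
  obtain ⟨ω, hω, hroot⟩ := hinf.exists_notMem_finset A.charpoly.roots.toFinset
  refine ⟨ω, by simpa using hω, ?_⟩
  rw [Matrix.isUnit_iff_isUnit_det, isUnit_iff_ne_zero, Matrix.smul_one_eq_diagonal]
  intro h
  apply hroot
  rw [Multiset.mem_toFinset, Polynomial.mem_roots A.charpoly_monic.ne_zero, Polynomial.IsRoot,
    Matrix.eval_charpoly]
  exact h

/-- The Cayley transform of a unitary matrix is Hermitian. -/
theorem Matrix.isHermitian_cayley {n : Type*} [Fintype n] [DecidableEq n] {A : Matrix n n ℂ}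
    (hA : Aᴴ * A = 1) {ω : ℂ} (hω : ‖ω‖ = 1) (hu : IsUnit (ω • (1 : Matrix n n ℂ) - A)) :
    (Complex.I • ((ω • 1 + A) * (ω • (1 : Matrix n n ℂ) - A)⁻¹)).IsHermitian := by
  set Y := ω • (1 : Matrix n n ℂ) - A with hY
  have hdet := (Matrix.isUnit_iff_isUnit_det _).mp hu
  have hωω : star ω * ω = 1 := by
    rw [Complex.star_def, ← Complex.normSq_eq_conj_mul_self, Complex.normSq_eq_norm_sq, hω]
    simp
  have hYH : Yᴴ = star ω • 1 - Aᴴ := by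
    rw [hY, Matrix.conjTranspose_sub, Matrix.conjTranspose_smul, Matrix.conjTranspose_one]
  have hK : Yᴴ * (Complex.I • (ω • 1 + A)) = Complex.I • (star ω • A - ω • Aᴴ) := by
    rw [hYH, Matrix.mul_smul, Matrix.sub_mul, Matrix.mul_add, Matrix.mul_add, hA]
    simp only [Matrix.smul_mul, Matrix.mul_smul, Matrix.one_mul, Matrix.mul_one, smul_smul, hωω,
      mul_comm ω, one_smul]
    congr 1
    abel
  have hKh : (Complex.I • (star ω • A - ω • Aᴴ)).IsHermitian := by
    unfold Matrix.IsHermitian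
    rw [Matrix.conjTranspose_smul, Matrix.conjTranspose_sub, Matrix.conjTranspose_smul,
      Matrix.conjTranspose_smul, Matrix.conjTranspose_conjTranspose, star_star, Complex.star_def,
      Complex.conj_I, neg_smul, ← smul_neg, neg_sub]
  have h1 : Complex.I • ((ω • 1 + A) * Y⁻¹) =
      (Y⁻¹)ᴴ * (Complex.I • (star ω • A - ω • Aᴴ)) * Y⁻¹ := by
    rw [← hK, ← Matrix.mul_assoc (Y⁻¹)ᴴ, ← Matrix.conjTranspose_mul, Matrix.mul_nonsing_inv _ hdet,
      Matrix.conjTranspose_one, Matrix.one_mul, Matrix.smul_mul]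
  rw [h1]
  exact Matrix.isHermitian_conjTranspose_mul_mul _ hKh

theorem Matrix.isDiag_of_isDiag_cayley {n : Type*} [Fintype n] [DecidableEq n]
    {A X : Matrix n n ℂ} {ω : ℂ} (hX : Xᴴ * X = 1) (hu : IsUnit (ω • (1 : Matrix n n ℂ) - A))
    (hh : (Complex.I • ((ω • 1 + A) * (ω • (1 : Matrix n n ℂ) - A)⁻¹)).IsHermitian)
    (hd : (Xᴴ * (Complex.I • ((ω • 1 + A) * (ω • (1 : Matrix n n ℂ) - A)⁻¹)) * X).IsDiag) :
    (Xᴴ * A * X).IsDiag := by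
  set Y := ω • (1 : Matrix n n ℂ) - A with hY
  set H := Complex.I • ((ω • 1 + A) * Y⁻¹) with hH
  have hdet := (Matrix.isUnit_iff_isUnit_det _).mp hu
  have hframe : IsEigenframe H X := ⟨hX, hd⟩
  have hcomm : Commute (ω • 1 + A) Y := by
    have h1 : Commute (ω • (1 : Matrix n n ℂ)) A := (Commute.one_left A).smul_left ω
    have h2 : Commute (ω • (1 : Matrix n n ℂ)) (ω • 1) := Commute.refl _
    exact (h2.sub_right h1).add_left (h1.symm.sub_right (Commute.refl A))
  have hYH : Y * H = Complex.I • (ω • 1 + A) := by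
    rw [hH, Matrix.mul_smul, ← Matrix.mul_assoc, ← hcomm.eq, Matrix.mul_assoc,
      Matrix.mul_nonsing_inv _ hdet, Matrix.mul_one]
  set a := Matrix.diag (Xᴴ * H * X) with ha
  have hreal : ∀ k, star (a k) = a k := fun k =>
    (Matrix.isHermitian_conjTranspose_mul_mul X hh).apply k k
  have h1 : Complex.I • (ω • X + A * X) = ω • (X * Matrix.diagonal a) - A * X * Matrix.diagonal a := by
    have := congrArg (Y * ·) hframe.mul_eq
    simp only [← Matrix.mul_assoc, hYH] at this
    rw [← ha, Matrix.mul_assoc, hY, Matrix.sub_mul] at this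
    simpa [Matrix.smul_mul, Matrix.add_mul, Matrix.mul_assoc] using this
  have h2 : Complex.I • (ω • 1 + Xᴴ * A * X) =
      ω • Matrix.diagonal a - Xᴴ * A * X * Matrix.diagonal a := by
    have := congrArg (Xᴴ * ·) h1
    simp only [Matrix.mul_smul, Matrix.mul_add, Matrix.mul_sub, ← Matrix.mul_assoc, hX,
      Matrix.one_mul] at this
    exact this
  intro j k hjk
  have h3 := congrFun (congrFun h2 j) k
  simp only [Matrix.smul_apply, Matrix.add_apply, Matrix.sub_apply, Matrix.one_apply_ne hjk,
    Matrix.mul_diagonal, Matrix.diagonal_apply_ne _ hjk, smul_eq_mul, mul_zero, zero_add,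
    zero_sub] at h3
  have h4 : (Complex.I + a k) * (Xᴴ * A * X) j k = 0 := by linear_combination h3
  refine (mul_eq_zero.mp h4).resolve_left fun h5 => ?_
  have h6 := congrArg Complex.im h5
  have h7 : (a k).im = 0 := Complex.conj_eq_iff_im.mp (hreal k)
  simp [h7] at h6

theorem locallyDiagonalizable_of_unitary {n : Type} [Fintype n] [DecidableEq n]
    {A : ℝ → Matrix n n ℂ} {t₀ : ℝ} (hA : AnalyticAt ℝ A t₀)
    (hu : ∀ t, (A t)ᴴ * A t = 1) : LocallyDiagonalizable A t₀ := by
  obtain ⟨ω, hω, hunit⟩ := (A t₀).exists_norm_one_isUnit_smul_sub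
  have hY : AnalyticAt ℝ (fun t => ω • (1 : Matrix n n ℂ) - A t) t₀ := analyticAt_const.sub hA
  have hYu : ∀ᶠ t in 𝓝 t₀, IsUnit (ω • (1 : Matrix n n ℂ) - A t) :=
    hY.continuousAt.eventually (Units.isOpen.mem_nhds hunit)
  have hinv : AnalyticAt ℝ (fun t => (ω • (1 : Matrix n n ℂ) - A t)⁻¹) t₀ := by
    simp only [Matrix.nonsing_inv_eq_ringInverse]
    obtain ⟨u, hu⟩ := hunit
    have h1 : AnalyticAt ℝ Ring.inverse (ω • (1 : Matrix n n ℂ) - A t₀) := by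
      rw [← hu]; exact analyticAt_inverse u
    exact AnalyticAt.comp (g := Ring.inverse) h1 hY
  have hH : AnalyticAt ℝ
      (fun t => Complex.I • ((ω • 1 + A t) * (ω • (1 : Matrix n n ℂ) - A t)⁻¹)) t₀ :=
    (analyticAt_const (v := Complex.I)).smul ((analyticAt_const.add hA).mul hinv)
  obtain ⟨X, hX, hXe⟩ := locallyDiagonalizable_of_isHermitian _ n _ t₀ rfl hH
    (hYu.mono fun t ht => Matrix.isHermitian_cayley (hu t) hω ht)
  refine ⟨X, hX, ?_⟩
  filter_upwards [hXe, hYu] with t h1 h2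
  exact ⟨h1.1, Matrix.isDiag_of_isDiag_cayley h1.1 h2 (Matrix.isHermitian_cayley (hu t) hω h2) h1.2⟩

theorem analyticAt_vMat {d : ℕ} (p : Fin d → ℝ) (t₀ : ℝ) : AnalyticAt ℝ (vMat p) t₀ := by
  have h1 : vMat p = fun t : ℝ => NormedSpace.exp (t • (Complex.I • dPlus p)) := by
    funext t
    rw [vMat_eq_exp]
    congr 1
    ext i j
    simp
    ring
  rw [h1]
  exact AnalyticAt.comp (g := NormedSpace.exp)
    (NormedSpace.exp_analytic (𝕂 := ℝ) (t₀ • (Complex.I • dPlus p)))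
    (analyticAt_id.smul analyticAt_const)

variable {d : ℕ} {U : Matrix (Fin d) (Fin d) ℂ} {p : Fin d → ℝ}

theorem vMat_unitary (p : Fin d → ℝ) (t : ℝ) : (vMat p t)ᴴ * vMat p t = 1 := by
  rw [vMat, Matrix.diagonal_conjTranspose, Matrix.diagonal_mul_diagonal, ← Matrix.diagonal_one]
  congr 1
  funext i
  rw [Pi.star_apply, Complex.star_def, ← Complex.exp_conj, ← Complex.exp_add]
  simp

theorem vMat_zero (p : Fin d → ℝ) : vMat p 0 = 1 := by
  simp [vMat]

theorem vMat_add (p : Fin d → ℝ) (s t : ℝ) : vMat p (s + t) = vMat p s * vMat p t := by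
  rw [vMat, vMat, vMat, Matrix.diagonal_mul_diagonal]
  congr 1
  funext i
  rw [← Complex.exp_add]
  congr 1
  push_cast
  ring

theorem mul_vMat_unitary (hU : U ∈ Matrix.unitaryGroup (Fin d) ℂ) (p : Fin d → ℝ) (t : ℝ) :
    (U * vMat p t)ᴴ * (U * vMat p t) = 1 := by
  have hU' : Uᴴ * U = 1 := Matrix.mem_unitaryGroup_iff'.mp hU
  rw [Matrix.conjTranspose_mul, Matrix.mul_assoc, ← Matrix.mul_assoc Uᴴ, hU', Matrix.one_mul,
    vMat_unitary]

theorem exists_isEigSystem (hU : U ∈ Matrix.unitaryGroup (Fin d) ℂ) (p : Fin d → ℝ) :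
    ∃ lam x, IsEigSystem U p lam x := by
  obtain ⟨X, hX, hXf⟩ := exists_continuousOn_eigenframe (A := fun t => U * vMat p t)
    (fun t => analyticAt_const.mul (analyticAt_vMat p t))
    (fun t => locallyDiagonalizable_of_unitary (analyticAt_const.mul (analyticAt_vMat p t))
      (mul_vMat_unitary hU p))
  refine ⟨fun j t => ((X t)ᴴ * (U * vMat p t) * X t) j j,
    fun j t => WithLp.toLp 2 fun i => X t i j, ?_, ?_, ?_⟩
  · intro t ht
    rw [orthonormal_iff_ite]
    intro i j
    have h1 := congrFun (congrFun (hXf t ht).1 i) j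
    rw [Matrix.mul_apply, Matrix.one_apply] at h1
    rw [← h1]
    simp [PiLp.inner_apply, mul_comm]
  · intro t ht j
    have h1 := (hXf t ht).mul_eq
    ext i
    have h2 := congrFun (congrFun h1 i) j
    rw [Matrix.mul_diagonal, mul_comm] at h2
    exact h2
  · intro j
    refine (PiLp.continuous_toLp 2 _).comp_continuousOn (continuousOn_pi.mpr fun i => ?_)
    have h1 : Continuous fun M : Matrix (Fin d) (Fin d) ℂ => M i j :=
      continuous_id.matrix_elem i j
    exact h1.comp_continuousOn hX

end CayleyTransform

section EigenbasisAlgebra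

theorem exists_equiv_of_map_univ_eq {ι κ α : Type*} [Fintype ι] [Fintype κ] [DecidableEq α]
    {f : ι → α} {g : κ → α}
    (h : (Finset.univ : Finset ι).val.map f = (Finset.univ : Finset κ).val.map g) :
    ∃ e : ι ≃ κ, ∀ i, g (e i) = f i := by
  have hc : ∀ a, Nonempty ({i // f i = a} ≃ {k // g k = a}) := fun a => by
    rw [← Fintype.card_eq, Fintype.card_subtype, Fintype.card_subtype]
    have h1 := congrArg (Multiset.count a) h
    rw [Multiset.count_map, Multiset.count_map] at h1
    simpa only [Finset.card_def, Finset.filter_val, eq_comm] using h1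
  exact ⟨Equiv.ofFiberEquiv fun a => (hc a).some, fun i => Equiv.ofFiberEquiv_map _ i⟩

variable {n : ℕ} {A : Matrix (Fin n) (Fin n) ℂ}

theorem Orthonormal.exists_orthonormalBasis {ι : Type*} [Fintype ι] {y : ι → EuclideanSpace ℂ (Fin n)}
    (hy : Orthonormal ℂ y) (hι : Fintype.card ι = n) :
    ∃ b : OrthonormalBasis ι ℂ (EuclideanSpace ℂ (Fin n)), ∀ j, b j = y j := by
  have h1 : Submodule.span ℂ (Set.range y) = ⊤ :=
    hy.linearIndependent.span_eq_top_of_card_eq_finrank' (by simp [hι])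
  exact ⟨OrthonormalBasis.mk hy h1.ge, fun j => by simp⟩

theorem isEigvalList_of_eigenbasis {y : Fin n → EuclideanSpace ℂ (Fin n)} {a : Fin n → ℂ} (hy : Orthonormal ℂ y)
    (ha : ∀ j, Matrix.toEuclideanLin A (y j) = a j • y j) : IsEigvalList A a := by
  let X : Matrix (Fin n) (Fin n) ℂ := Matrix.of fun i j => y j i
  have hX : Xᴴ * X = 1 := by
    ext i j
    have h1 := orthonormal_iff_ite.mp hy i j
    rw [Matrix.mul_apply, Matrix.one_apply, ← h1]
    simp [X, PiLp.inner_apply, mul_comm]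
  have hAX : A * X = X * Matrix.diagonal a := by
    ext i j
    rw [Matrix.mul_diagonal, mul_comm]
    exact congrArg (fun v : EuclideanSpace ℂ (Fin n) => v i) (ha j)
  have h2 : A.charpoly = (Matrix.diagonal a).charpoly := by
    have h3 : Xᴴ * A * X = Matrix.diagonal a := by
      rw [Matrix.mul_assoc, hAX, ← Matrix.mul_assoc, hX, Matrix.one_mul]
    rw [← h3, Matrix.charpoly_mul_comm, ← Matrix.mul_assoc, mul_eq_one_comm.mp hX, Matrix.one_mul]
  unfold IsEigvalList
  rw [h2, Matrix.charpoly_diagonal]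
  have := Polynomial.roots_multiset_prod_X_sub_C ((Finset.univ : Finset (Fin n)).val.map a)
  rw [Multiset.map_map] at this
  exact this

theorem IsEigvalList.eigMult_eq_card {a : Fin n → ℂ} (h : IsEigvalList A a) (μ : ℂ) :
    eigMult A μ = Fintype.card {j // a j = μ} := by
  classical
  unfold eigMult
  rw [← Polynomial.count_roots, show A.charpoly.roots = _ from h, Multiset.count_map,
    Fintype.card_subtype, Finset.card_def, Finset.filter_val]
  simp only [eq_comm]

theorem inner_toEuclideanLin_toEuclideanLin {k : ℕ} {B : Matrix (Fin n) (Fin k) ℂ} (hB : Bᴴ * B = 1)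
    (x y : EuclideanSpace ℂ (Fin k)) :
    inner ℂ (Matrix.toEuclideanLin B x) (Matrix.toEuclideanLin B y) = inner ℂ x y := by
  rw [← LinearMap.adjoint_inner_right, ← Matrix.toEuclideanLin_conjTranspose_eq_adjoint,
    ← LinearMap.comp_apply, ← Matrix.toLpLin_mul, hB, Matrix.toLpLin_one, LinearMap.id_apply]

theorem norm_toEuclideanLin {k : ℕ} {B : Matrix (Fin n) (Fin k) ℂ} (hB : Bᴴ * B = 1)
    (x : EuclideanSpace ℂ (Fin k)) : ‖Matrix.toEuclideanLin B x‖ = ‖x‖ := by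
  rw [@norm_eq_sqrt_re_inner ℂ, inner_toEuclideanLin_toEuclideanLin hB, ← norm_eq_sqrt_re_inner]

theorem norm_eq_one_of_unitary_eigenvector (hA : Aᴴ * A = 1) {x : EuclideanSpace ℂ (Fin n)} {μ : ℂ} (hx : x ≠ 0)
    (h : Matrix.toEuclideanLin A x = μ • x) : ‖μ‖ = 1 := by
  have h1 := norm_toEuclideanLin hA x
  rw [h, norm_smul] at h1
  exact mul_right_cancel₀ (norm_ne_zero_iff.mpr hx) (by rw [h1, one_mul])

theorem star_mul_self_of_norm_one {μ : ℂ} (h : ‖μ‖ = 1) : star μ * μ = 1 := by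
  rw [Complex.star_def, ← Complex.normSq_eq_conj_mul_self, Complex.normSq_eq_norm_sq, h]
  simp

/-- An eigenvector of an isometric matrix is also a left eigenvector. -/
theorem inner_unitary_eigenvector (hA : Aᴴ * A = 1) {x : EuclideanSpace ℂ (Fin n)} {μ : ℂ} (hx : x ≠ 0)
    (h : Matrix.toEuclideanLin A x = μ • x) (y : EuclideanSpace ℂ (Fin n)) :
    inner ℂ x (Matrix.toEuclideanLin A y) = μ * inner ℂ x y := by
  have hμ := star_mul_self_of_norm_one (norm_eq_one_of_unitary_eigenvector hA hx h)
  rw [← inner_toEuclideanLin_toEuclideanLin hA x y, h, inner_smul_left, ← mul_assoc, mul_comm μ]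
  rw [Complex.star_def] at hμ
  rw [hμ, one_mul]

theorem inner_eq_zero_of_eigenvectors (hA : Aᴴ * A = 1) {x y : EuclideanSpace ℂ (Fin n)} {μ ν : ℂ} (hx : x ≠ 0)
    (h : Matrix.toEuclideanLin A x = μ • x) (h' : Matrix.toEuclideanLin A y = ν • y)
    (hne : μ ≠ ν) : inner ℂ x y = 0 := by
  have h1 := inner_unitary_eigenvector hA hx h y
  rw [h', inner_smul_right] at h1
  have h2 : (μ - ν) * inner ℂ x y = 0 := by linear_combination -h1
  exact (mul_eq_zero.mp h2).resolve_left (sub_ne_zero.mpr hne)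

variable {y : Fin n → EuclideanSpace ℂ (Fin n)} {a : Fin n → ℂ}

theorem mem_span_of_eigenbasis (hA : Aᴴ * A = 1) (hy : Orthonormal ℂ y)
    (ha : ∀ j, Matrix.toEuclideanLin A (y j) = a j • y j) {μ : ℂ} {x : EuclideanSpace ℂ (Fin n)}
    (hx : Matrix.toEuclideanLin A x = μ • x) :
    x ∈ Submodule.span ℂ (Set.range fun j : {j // a j = μ} => y j) := by
  obtain ⟨b, hb⟩ := hy.exists_orthonormalBasis (by simp)
  rw [← b.sum_repr' x]
  refine Submodule.sum_mem _ fun j _ => ?_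
  by_cases hj : a j = μ
  · rw [hb]
    exact Submodule.smul_mem _ _ (Submodule.subset_span ⟨⟨j, hj⟩, rfl⟩)
  · rw [hb, inner_eq_zero_of_eigenvectors hA (hy.ne_zero j) (ha j) hx hj, zero_smul]
    exact Submodule.zero_mem _

theorem isEigval_iff_of_eigenbasis (hA : Aᴴ * A = 1) (hy : Orthonormal ℂ y)
    (ha : ∀ j, Matrix.toEuclideanLin A (y j) = a j • y j) {μ : ℂ} :
    IsEigval A μ ↔ ∃ j, a j = μ := by
  constructor
  · intro h
    obtain ⟨x, hx⟩ := h.exists_hasEigenvector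
    by_contra! hcon
    have h1 := mem_span_of_eigenbasis hA hy ha hx.apply_eq_smul
    have : IsEmpty {j // a j = μ} := ⟨fun j => hcon j j.2⟩
    rw [Set.range_eq_empty, Submodule.span_empty] at h1
    exact hx.2 h1
  · rintro ⟨j, rfl⟩
    exact Module.End.hasEigenvalue_of_hasEigenvector
      (Module.End.hasEigenvector_iff.mpr ⟨Module.End.mem_eigenspace_iff.mpr (ha j), hy.ne_zero j⟩)

theorem finrank_eigenspace_of_eigenbasis (hA : Aᴴ * A = 1) (hy : Orthonormal ℂ y)
    (ha : ∀ j, Matrix.toEuclideanLin A (y j) = a j • y j) (μ : ℂ) :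
    Module.finrank ℂ (Module.End.eigenspace (Matrix.toEuclideanLin A) μ) = eigMult A μ := by
  have h1 : Module.End.eigenspace (Matrix.toEuclideanLin A) μ =
      Submodule.span ℂ (Set.range fun j : {j // a j = μ} => y j) := by
    apply le_antisymm
    · intro x hx
      exact mem_span_of_eigenbasis hA hy ha (Module.End.mem_eigenspace_iff.mp hx)
    · rw [Submodule.span_le]
      rintro _ ⟨j, rfl⟩
      exact Module.End.mem_eigenspace_iff.mpr ((ha j).trans (by rw [j.2]))
  have h2 := finrank_span_eq_card (R := ℂ)
    (hy.linearIndependent.comp (Subtype.val : {j // a j = μ} → Fin n) Subtype.val_injective)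
  rw [h1, (isEigvalList_of_eigenbasis hy ha).eigMult_eq_card, ← h2]
  rfl

end EigenbasisAlgebra

section Weight

variable {d : ℕ} {p : Fin d → ℝ}

theorem weight_nonneg (hp : ∀ i, 0 ≤ p i) (x : EuclideanSpace ℂ (Fin d)) : 0 ≤ weight p x :=
  Finset.sum_nonneg fun i _ => mul_nonneg (hp i) (sq_nonneg _)

theorem weight_smul (c : ℂ) (x : EuclideanSpace ℂ (Fin d)) :
    weight p (c • x) = ‖c‖ ^ 2 * weight p x := by
  simp only [weight, Finset.mul_sum, PiLp.smul_apply, mul_pow, smul_eq_mul, norm_mul]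
  exact Finset.sum_congr rfl fun i _ => by ring

theorem continuous_weight : Continuous (weight p) := by
  unfold weight
  fun_prop

theorem toEuclideanLin_vMat_apply (t : ℝ) (x : EuclideanSpace ℂ (Fin d)) (i : Fin d) :
    Matrix.toEuclideanLin (vMat p t) x i = Complex.exp (Complex.I * (p i : ℂ) * (t : ℂ)) * x i := by
  rw [vMat, Matrix.toLpLin_apply]
  simp [Matrix.mulVec_diagonal]

theorem toEuclideanLin_dPlus_apply (x : EuclideanSpace ℂ (Fin d)) (i : Fin d) :
    Matrix.toEuclideanLin (dPlus p) x i = (p i : ℂ) * x i := by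
  rw [dPlus, Matrix.toLpLin_apply]
  simp [Matrix.mulVec_diagonal]

theorem inner_dPlus_self (x : EuclideanSpace ℂ (Fin d)) :
    inner ℂ x (Matrix.toEuclideanLin (dPlus p) x) = (weight p x : ℂ) := by
  simp only [PiLp.inner_apply, toEuclideanLin_dPlus_apply, weight, Complex.ofReal_sum]
  refine Finset.sum_congr rfl fun i _ => ?_
  rw [RCLike.inner_apply, mul_assoc]
  push_cast
  rw [← Complex.ofReal_pow, ← Complex.normSq_eq_norm_sq, Complex.normSq_eq_conj_mul_self]
  ring

theorem vMat_fix_of_weight_eq_zero (hp : ∀ i, 0 ≤ p i) {x : EuclideanSpace ℂ (Fin d)}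
    (h : weight p x = 0) (t : ℝ) : Matrix.toEuclideanLin (vMat p t) x = x := by
  ext i
  rw [toEuclideanLin_vMat_apply]
  have h1 := (Finset.sum_eq_zero_iff_of_nonneg
    (fun i _ => mul_nonneg (hp i) (sq_nonneg ‖x i‖))).mp h i (Finset.mem_univ i)
  rcases mul_eq_zero.mp h1 with h2 | h2
  · simp [h2]
  · have : x i = 0 := by simpa using h2
    simp [this]

theorem sum_weight_orthonormal {y : Fin d → EuclideanSpace ℂ (Fin d)} (hy : Orthonormal ℂ y) :
    ∑ j, weight p (y j) = ∑ i, p i := by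
  obtain ⟨b, hb⟩ := hy.exists_orthonormalBasis (by simp)
  simp only [weight]
  rw [Finset.sum_comm]
  refine Finset.sum_congr rfl fun i _ => ?_
  rw [← Finset.mul_sum]
  have h1 := b.sum_sq_norm_inner_right (EuclideanSpace.single i (1 : ℂ))
  have h2 : ∀ j, ‖inner ℂ (b j) (EuclideanSpace.single i (1 : ℂ))‖ = ‖y j i‖ := fun j => by
    rw [EuclideanSpace.inner_single_right, hb]
    simp
  simp only [h2] at h1
  rw [h1]
  simp

theorem toEuclideanLin_mul_vMat_of_weight_eq_zero {U : Matrix (Fin d) (Fin d) ℂ}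
    (hp : ∀ i, 0 ≤ p i) {x : EuclideanSpace ℂ (Fin d)} (h : weight p x = 0) (s t : ℝ) :
    Matrix.toEuclideanLin (U * vMat p t) x = Matrix.toEuclideanLin (U * vMat p s) x := by
  rw [Matrix.toLpLin_mul 2 2 2, Matrix.toLpLin_mul 2 2 2, LinearMap.comp_apply, LinearMap.comp_apply,
    vMat_fix_of_weight_eq_zero hp h, vMat_fix_of_weight_eq_zero hp h]

end Weight

section EigenvalueDerivatives

variable {d : ℕ} {U : Matrix (Fin d) (Fin d) ℂ} {p : Fin d → ℝ}
  {lam : Fin d → ℝ → ℂ} {x : Fin d → ℝ → EuclideanSpace ℂ (Fin d)}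

theorem IsEigSystem.inner_eq (hU : U ∈ Matrix.unitaryGroup (Fin d) ℂ) (h : IsEigSystem U p lam x)
    {s t : ℝ} (hs : 0 ≤ s) (ht : 0 ≤ t) (i j : Fin d) :
    lam j s * inner ℂ (x i t) (x j s) =
      lam i t * inner ℂ (x i t) (Matrix.toEuclideanLin (vMat p (s - t)) (x j s)) := by
  rw [← inner_unitary_eigenvector (mul_vMat_unitary hU p t) ((h.orthonormal t ht).ne_zero i)
    (h.eigen t ht i), ← LinearMap.comp_apply, ← Matrix.toLpLin_mul, Matrix.mul_assoc, ← vMat_add,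
    add_sub_cancel, h.eigen s hs j, inner_smul_right]

theorem tendsto_inner_vMat_slope {S : Set ℝ} {t : ℝ} {y : ℝ → EuclideanSpace ℂ (Fin d)}
    (hy : Filter.Tendsto y (𝓝[S \ {t}] t) (𝓝 (y t))) (z : EuclideanSpace ℂ (Fin d)) :
    Filter.Tendsto (fun s : ℝ => (s - t)⁻¹ •
        (inner ℂ z (Matrix.toEuclideanLin (vMat p (s - t)) (y s)) - inner ℂ z (y s)))
      (𝓝[S \ {t}] t) (𝓝 (Complex.I * inner ℂ z (Matrix.toEuclideanLin (dPlus p) (y t)))) := by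
  have hexp : ∀ i, Filter.Tendsto
      (fun s : ℝ => (s - t)⁻¹ • (Complex.exp (Complex.I * (p i : ℂ) * ((s - t : ℝ) : ℂ)) - 1))
      (𝓝[S \ {t}] t) (𝓝 (Complex.I * (p i : ℂ))) := fun i => by
    have h0 : HasDerivAt (fun s : ℝ => ((s - t : ℝ) : ℂ)) 1 t := by
      have := ((hasDerivAt_id t).sub_const t).ofReal_comp
      simpa using this
    have h1 : HasDerivAt (fun s : ℝ => Complex.exp (Complex.I * (p i : ℂ) * ((s - t : ℝ) : ℂ)))
        (Complex.I * (p i : ℂ)) t := by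
      have := (h0.const_mul (Complex.I * (p i : ℂ))).cexp
      simpa using this
    have h2 := (hasDerivWithinAt_iff_tendsto_slope.mp (h1.hasDerivWithinAt (s := S)))
    refine h2.congr fun s => ?_
    simp [slope]
  have hcoord : ∀ i, Filter.Tendsto (fun s => y s i) (𝓝[S \ {t}] t) (𝓝 (y t i)) := fun i =>
    ((EuclideanSpace.proj (𝕜 := ℂ) i).continuous.tendsto (y t)).comp hy
  have hsum : Filter.Tendsto (fun s : ℝ => ∑ i, ((s - t)⁻¹ •
      (Complex.exp (Complex.I * (p i : ℂ) * ((s - t : ℝ) : ℂ)) - 1)) * y s i * star (z i))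
      (𝓝[S \ {t}] t) (𝓝 (∑ i, Complex.I * (p i : ℂ) * y t i * star (z i))) :=
    tendsto_finsetSum _ fun i _ => ((hexp i).mul (hcoord i)).mul_const _
  have hval : Complex.I * inner ℂ z (Matrix.toEuclideanLin (dPlus p) (y t)) =
      ∑ i, Complex.I * (p i : ℂ) * y t i * star (z i) := by
    simp only [PiLp.inner_apply, toEuclideanLin_dPlus_apply, RCLike.inner_apply, Finset.mul_sum]
    exact Finset.sum_congr rfl fun i _ => by rw [Complex.star_def]; ring
  rw [hval]
  refine hsum.congr fun s => ?_
  simp only [PiLp.inner_apply, toEuclideanLin_vMat_apply, RCLike.inner_apply]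
  rw [← Finset.sum_sub_distrib, Finset.smul_sum]
  refine Finset.sum_congr rfl fun i _ => ?_
  rw [Complex.star_def]
  simp only [Complex.real_smul]
  ring

/-- First order perturbation: the limit of the matrix elements of the difference quotient. -/
theorem IsEigSystem.tendsto_slope_mul_inner (hU : U ∈ Matrix.unitaryGroup (Fin d) ℂ)
    (h : IsEigSystem U p lam x) {t : ℝ} (ht : 0 ≤ t) (i j : Fin d) :
    Filter.Tendsto (fun s : ℝ => (s - t)⁻¹ • ((lam j s - lam i t) * inner ℂ (x i t) (x j s)))
      (𝓝[Set.Ici 0 \ {t}] t)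
      (𝓝 (lam i t * (Complex.I * inner ℂ (x i t) (Matrix.toEuclideanLin (dPlus p) (x j t))))) := by
  have hx : Filter.Tendsto (x j) (𝓝[Set.Ici 0 \ {t}] t) (𝓝 (x j t)) :=
    (h.continuousOn j t ht).tendsto.mono_left (nhdsWithin_mono _ Set.sdiff_subset)
  refine ((tendsto_inner_vMat_slope (p := p) hx (x i t)).const_mul (lam i t)).congr' ?_
  filter_upwards [self_mem_nhdsWithin] with s hs
  rw [mul_smul_comm, mul_sub, ← h.inner_eq hU hs.1 ht, sub_mul]

theorem IsEigSystem.tendsto_inner (h : IsEigSystem U p lam x) {t : ℝ} (ht : 0 ≤ t) (i j : Fin d) :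
    Filter.Tendsto (fun s : ℝ => inner ℂ (x i t) (x j s)) (𝓝[Set.Ici 0 \ {t}] t)
      (𝓝 (inner ℂ (x i t) (x j t))) := by
  have hx : Filter.Tendsto (x j) (𝓝[Set.Ici 0 \ {t}] t) (𝓝 (x j t)) :=
    (h.continuousOn j t ht).tendsto.mono_left (nhdsWithin_mono _ Set.sdiff_subset)
  exact tendsto_const_nhds.inner hx

theorem IsEigSystem.hasDerivWithinAt (hU : U ∈ Matrix.unitaryGroup (Fin d) ℂ)
    (h : IsEigSystem U p lam x) {t : ℝ} (ht : 0 ≤ t) (j : Fin d) :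
    HasDerivWithinAt (lam j) (Complex.I * lam j t * (weight p (x j t) : ℂ)) (Set.Ici 0) t := by
  rw [hasDerivWithinAt_iff_tendsto_slope]
  have h1 := h.tendsto_slope_mul_inner hU ht j j
  have h2 := h.tendsto_inner ht j j
  have hone : inner ℂ (x j t) (x j t) = 1 := by
    rw [orthonormal_iff_ite.mp (h.orthonormal t ht) j j, if_pos rfl]
  rw [hone] at h2
  have h3 := h1.div h2 one_ne_zero
  rw [inner_dPlus_self, div_one] at h3
  rw [show Complex.I * lam j t * (weight p (x j t) : ℂ) =
    lam j t * (Complex.I * (weight p (x j t) : ℂ)) by ring]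
  refine h3.congr' ?_
  filter_upwards [h2.eventually_ne one_ne_zero] with s hs
  simp only [Pi.div_apply, slope, vsub_eq_sub, Complex.real_smul]
  field_simp

theorem IsEigSystem.continuousOn_lam (hU : U ∈ Matrix.unitaryGroup (Fin d) ℂ)
    (h : IsEigSystem U p lam x) (j : Fin d) : ContinuousOn (lam j) (Set.Ici 0) :=
  fun _ ht => (h.hasDerivWithinAt hU ht j).continuousWithinAt

theorem IsEigSystem.isEigvalCurves (hU : U ∈ Matrix.unitaryGroup (Fin d) ℂ)
    (h : IsEigSystem U p lam x) : IsEigvalCurves U p lam :=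
  ⟨fun t ht => isEigvalList_of_eigenbasis (h.orthonormal t ht) (h.eigen t ht),
    h.continuousOn_lam hU⟩

theorem IsEigSystem.inner_dPlus_eq_zero (hU : U ∈ Matrix.unitaryGroup (Fin d) ℂ)
    (h : IsEigSystem U p lam x) {t : ℝ} (ht : 0 ≤ t) {i j : Fin d} (hij : i ≠ j)
    (hlam : lam i t = lam j t) :
    inner ℂ (x i t) (Matrix.toEuclideanLin (dPlus p) (x j t)) = 0 := by
  have h1 := h.tendsto_slope_mul_inner hU ht i j
  have h2 := (hasDerivWithinAt_iff_tendsto_slope.mp (h.hasDerivWithinAt hU ht j)).mul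
    (h.tendsto_inner ht i j)
  rw [orthonormal_iff_ite.mp (h.orthonormal t ht) i j, if_neg hij, mul_zero] at h2
  have hne : (𝓝[Set.Ici (0 : ℝ) \ {t}] t).NeBot := by
    have : 𝓝[>] t ≤ 𝓝[Set.Ici (0 : ℝ) \ {t}] t :=
      nhdsWithin_mono _ fun s hs => ⟨ht.trans (le_of_lt hs), ne_of_gt hs⟩
    exact Filter.neBot_of_le this
  have h3 := tendsto_nhds_unique h1 (h2.congr fun s => by
    simp only [slope, vsub_eq_sub, Complex.real_smul, hlam]; ring)
  have h4 : lam i t ≠ 0 := by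
    have := norm_eq_one_of_unitary_eigenvector (mul_vMat_unitary hU p t)
      ((h.orthonormal t ht).ne_zero i) (h.eigen t ht i)
    intro h0
    simp [h0] at this
  simpa [h4] using h3

theorem IsEigSystem.norm_lam (hU : U ∈ Matrix.unitaryGroup (Fin d) ℂ)
    (h : IsEigSystem U p lam x) {t : ℝ} (ht : 0 ≤ t) (j : Fin d) : ‖lam j t‖ = 1 :=
  norm_eq_one_of_unitary_eigenvector (mul_vMat_unitary hU p t)
      ((h.orthonormal t ht).ne_zero j) (h.eigen t ht j)

theorem IsEigSystem.isEigval_iff (hU : U ∈ Matrix.unitaryGroup (Fin d) ℂ)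
    (h : IsEigSystem U p lam x) {t : ℝ} (ht : 0 ≤ t) {μ : ℂ} :
    IsEigval (U * vMat p t) μ ↔ ∃ j, lam j t = μ :=
  isEigval_iff_of_eigenbasis (mul_vMat_unitary hU p t) (h.orthonormal t ht) (h.eigen t ht)

end EigenvalueDerivatives

section RightDerivatives

/-- A continuous function that approaches a finite set has a limit. -/
theorem exists_tendsto_of_eventually_near_finset {q : ℝ → ℂ} {t : ℝ}
    (hq : ContinuousOn q (Set.Ioi t)) (C : Finset ℂ)
    (h : ∀ ε > 0, ∀ᶠ s in 𝓝[>] t, ∃ c ∈ C, dist (q s) c < ε) :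
    ∃ c ∈ C, Filter.Tendsto q (𝓝[>] t) (𝓝 c) := by
  obtain ⟨δ, hδ, hsep⟩ : ∃ δ > 0, ∀ c ∈ C, ∀ c' ∈ C, c ≠ c' → δ ≤ dist c c' := by
    by_cases hne : (C.offDiag).Nonempty
    · refine ⟨C.offDiag.inf' hne fun z => dist z.1 z.2, ?_, fun c hc c' hc' hcc => ?_⟩
      · rw [gt_iff_lt, Finset.lt_inf'_iff]
        intro z hz
        exact dist_pos.mpr (Finset.mem_offDiag.mp hz).2.2
      · exact Finset.inf'_le (fun z : ℂ × ℂ => dist z.1 z.2)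
          (b := (c, c')) (Finset.mem_offDiag.mpr ⟨hc, hc', hcc⟩)
    · refine ⟨1, one_pos, fun c hc c' hc' hcc => absurd ?_ hne⟩
      exact ⟨(c, c'), Finset.mem_offDiag.mpr ⟨hc, hc', hcc⟩⟩
  have hδ4 : 0 < δ / 4 := by linarith
  obtain ⟨c₀, hc₀, hfreq⟩ : ∃ c ∈ C, ∃ᶠ s in 𝓝[>] t, dist (q s) c < δ / 4 := by
    by_contra! hcon
    have h1 : ∀ᶠ s in 𝓝[>] t, ∀ c ∈ C, ¬ dist (q s) c < δ / 4 := by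
      rw [Filter.eventually_all_finset]
      exact fun c hc => (hcon c hc).mono fun s hs => not_lt.mpr hs
    obtain ⟨s, hs1, c, hc, hs2⟩ := (h1.and (h _ hδ4)).exists
    exact hs1 c hc hs2
  have hnear : ∀ᶠ s in 𝓝[>] t, dist (q s) c₀ < δ / 2 := by
    obtain ⟨u, hu, hsub⟩ := mem_nhdsGT_iff_exists_Ioo_subset.mp (h _ hδ4)
    have hconn : (fun s => dist (q s) c₀) '' Set.Ioo t u |>.OrdConnected := by
      refine (isPreconnected_Ioo.image _ ?_).ordConnected
      exact (continuous_id.dist continuous_const).comp_continuousOn (hq.mono Set.Ioo_subset_Ioi_self)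
    have hmem : Set.Ioo t u ∈ 𝓝[>] t := Ioo_mem_nhdsGT hu
    obtain ⟨s₀, hs₀, hs₀I⟩ := (hfreq.and_eventually hmem).exists
    filter_upwards [hmem] with s hs
    by_contra! hge
    obtain ⟨r, hr, hr2⟩ := hconn.out ⟨s₀, hs₀I, rfl⟩ ⟨s, hs, rfl⟩
      (show δ / 2 ∈ Set.Icc _ _ from ⟨by simp only; linarith, hge⟩)
    simp only at hr2
    obtain ⟨c, hc, hrc⟩ := hsub hr
    by_cases hcc : c = c₀
    · rw [hcc] at hrc; linarith
    · have h1 := hsep c hc c₀ hc₀ hcc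
      have h2 := dist_triangle_left c c₀ (q r)
      linarith
  refine ⟨c₀, hc₀, Metric.tendsto_nhds.mpr fun ε hε => ?_⟩
  filter_upwards [hnear, h (min ε (δ / 4)) (lt_min hε hδ4)] with s h1 ⟨c, hc, h2⟩
  by_cases hcc : c = c₀
  · rw [hcc] at h2; exact h2.trans_le (min_le_left _ _)
  · have h3 := hsep c hc c₀ hc₀ hcc
    have h4 := dist_triangle_left c c₀ (q s)
    have h5 := h2.trans_le (min_le_right _ _)
    linarith

theorem hasDerivWithinAt_Ici_iff_tendsto_slope {f : ℝ → ℂ} {c : ℂ} {t : ℝ} :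
    HasDerivWithinAt f c (Set.Ici t) t ↔ Filter.Tendsto (slope f t) (𝓝[>] t) (𝓝 c) := by
  rw [← hasDerivWithinAt_Ioi_iff_Ici, hasDerivWithinAt_iff_tendsto_slope' Set.self_notMem_Ioi]

/-- A continuous selection from finitely many right differentiable functions is right
differentiable. -/
theorem exists_hasDerivWithinAt_of_selection {ι : Type*} [Fintype ι] {f : ℝ → ℂ} {g : ι → ℝ → ℂ}
    {c : ι → ℂ} {t : ℝ} (hf : ContinuousOn f (Set.Ici t))
    (hg : ∀ a, HasDerivWithinAt (g a) (c a) (Set.Ici t) t)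
    (hsel : ∀ s, t ≤ s → ∃ a, f s = g a s) :
    ∃ a, f t = g a t ∧ HasDerivWithinAt f (c a) (Set.Ici t) t := by
  classical
  have hgc : ∀ a, Filter.Tendsto (g a) (𝓝[>] t) (𝓝 (g a t)) := fun a =>
    (hg a).continuousWithinAt.tendsto.mono_left (nhdsWithin_mono _ Set.Ioi_subset_Ici_self)
  have hfc : Filter.Tendsto f (𝓝[>] t) (𝓝 (f t)) :=
    (hf t Set.self_mem_Ici).tendsto.mono_left (nhdsWithin_mono _ Set.Ioi_subset_Ici_self)
  have hsel' : ∀ᶠ s in 𝓝[>] t, ∃ a, f t = g a t ∧ f s = g a s := by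
    have h1 : ∀ᶠ s in 𝓝[>] t, ∀ a, f t ≠ g a t → f s ≠ g a s := by
      rw [Filter.eventually_all]
      intro a
      by_cases ha : f t = g a t
      · exact Filter.Eventually.of_forall fun s hs => absurd ha hs
      · exact ((hfc.sub (hgc a)).eventually_ne (sub_ne_zero.mpr ha)).mono
          fun s hs _ => sub_ne_zero.mp hs
    filter_upwards [h1, self_mem_nhdsWithin] with s hs hst
    obtain ⟨a, ha⟩ := hsel s (le_of_lt hst)
    exact ⟨a, not_not.mp fun h => hs a h ha, ha⟩
  have hq : ContinuousOn (slope f t) (Set.Ioi t) := by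
    have h1 : ContinuousOn f (Set.Ioi t) := hf.mono Set.Ioi_subset_Ici_self
    simp only [slope_fun_def, vsub_eq_sub]
    have h2 : ContinuousOn (fun s : ℝ => (s - t)⁻¹) (Set.Ioi t) :=
      ContinuousOn.inv₀ (continuousOn_id.sub continuousOn_const)
        fun s hs => sub_ne_zero.mpr (ne_of_gt hs)
    exact ContinuousOn.smul (f := fun s : ℝ => (s - t)⁻¹) h2 (h1.sub continuousOn_const)
  obtain ⟨c₀, hc₀, hlim⟩ := exists_tendsto_of_eventually_near_finset hq
    ((Finset.univ.filter fun a => f t = g a t).image c) (fun ε hε => by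
      have h1 : ∀ᶠ s in 𝓝[>] t, ∀ a, dist (slope (g a) t s) (c a) < ε := by
        rw [Filter.eventually_all]
        exact fun a => Metric.tendsto_nhds.mp
          (hasDerivWithinAt_Ici_iff_tendsto_slope.mp (hg a)) ε hε
      filter_upwards [h1, hsel'] with s hs ⟨a, ha, has⟩
      refine ⟨c a, Finset.mem_image.mpr ⟨a, by simp [ha], rfl⟩, ?_⟩
      have : slope f t s = slope (g a) t s := by simp [slope, ha, has]
      rw [this]
      exact hs a)
  obtain ⟨a, ha, rfl⟩ := Finset.mem_image.mp hc₀
  exact ⟨a, (Finset.mem_filter.mp ha).2, hasDerivWithinAt_Ici_iff_tendsto_slope.mpr hlim⟩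

variable {d : ℕ} {U : Matrix (Fin d) (Fin d) ℂ} {p : Fin d → ℝ}
  {lam mu : Fin d → ℝ → ℂ} {x : Fin d → ℝ → EuclideanSpace ℂ (Fin d)}

/-- A continuous labelling has the right derivatives of an eigensystem, up to a permutation. -/
theorem IsEigvalCurves.exists_perm_hasDerivWithinAt (hU : U ∈ Matrix.unitaryGroup (Fin d) ℂ)
    (h : IsEigSystem U p lam x) (hmu : IsEigvalCurves U p mu) {t : ℝ} (ht : 0 ≤ t) :
    ∃ σ : Equiv.Perm (Fin d), ∀ j, mu j t = lam (σ j) t ∧ HasDerivWithinAt (mu j)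
      (Complex.I * lam (σ j) t * (weight p (x (σ j) t) : ℂ)) (Set.Ici t) t := by
  have hsub : Set.Ici t ⊆ Set.Ici 0 := Set.Ici_subset_Ici.mpr ht
  have hperm : ∀ s, t ≤ s → ∃ σ : Equiv.Perm (Fin d), ∀ j, lam (σ j) s = mu j s := fun s hs =>
    exists_equiv_of_map_univ_eq ((hmu.isEigvalList s (ht.trans hs)).symm.trans
      ((h.isEigvalCurves hU).isEigvalList s (ht.trans hs)))
  have hlam : ∀ a, HasDerivWithinAt (lam a) (Complex.I * lam a t * (weight p (x a t) : ℂ))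
      (Set.Ici t) t := fun a => (h.hasDerivWithinAt hU ht a).mono hsub
  obtain ⟨σ, hσ⟩ : ∃ σ : Equiv.Perm (Fin d), ∃ᶠ s in 𝓝[>] t, ∀ j, lam (σ j) s = mu j s := by
    by_contra! hcon
    have h1 : ∀ᶠ s in 𝓝[>] t, ∀ σ : Equiv.Perm (Fin d), ¬ ∀ j, lam (σ j) s = mu j s := by
      rw [Filter.eventually_all]
      exact fun σ => (hcon σ).mono fun s ⟨j, hj⟩ h => hj (h j)
    obtain ⟨s, hs, hst⟩ := (h1.and self_mem_nhdsWithin).exists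
    obtain ⟨σ, hσ⟩ := hperm s (le_of_lt hst)
    exact hs σ hσ
  refine ⟨σ, fun j => ?_⟩
  have hfreq : ∃ᶠ s in 𝓝[>] t, mu j s = lam (σ j) s := hσ.mono fun s hs => (hs j).symm
  have hval : mu j t = lam (σ j) t :=
    tendsto_nhds_unique_of_frequently_eq
      ((hmu.continuousOn j t ht).tendsto.mono_left
        (nhdsWithin_mono _ (Set.Ioi_subset_Ici_self.trans hsub)))
      ((hlam (σ j)).continuousWithinAt.tendsto.mono_left
        (nhdsWithin_mono _ Set.Ioi_subset_Ici_self)) hfreq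
  obtain ⟨a, -, ha⟩ := exists_hasDerivWithinAt_of_selection ((hmu.continuousOn j).mono hsub) hlam
    fun s hs => by
      obtain ⟨τ, hτ⟩ := hperm s hs
      exact ⟨τ j, (hτ j).symm⟩
  have hder := tendsto_nhds_unique_of_frequently_eq
    (hasDerivWithinAt_Ici_iff_tendsto_slope.mp ha)
    (hasDerivWithinAt_Ici_iff_tendsto_slope.mp (hlam (σ j)))
    (hfreq.mono fun s hs => by simp [slope, hs, hval])
  exact ⟨hval, hder ▸ ha⟩

end RightDerivatives

section Angle

theorem monotoneOn_Ici_of_right_deriv_nonneg {θ w : ℝ → ℝ} (hθ : ContinuousOn θ (Set.Ici 0))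
    (hd : ∀ t, 0 ≤ t → HasDerivWithinAt θ (w t) (Set.Ici t) t) (hw : ∀ t, 0 ≤ t → 0 ≤ w t) :
    MonotoneOn θ (Set.Ici 0) := by
  intro a ha b hb hab
  have hsub : Set.Icc a b ⊆ Set.Ici 0 := fun s hs => le_trans ha hs.1
  have h1 := image_le_of_deriv_right_le_deriv_boundary (f := fun s => -θ s) (f' := fun s => -w s)
    (a := a) (b := b) (B := fun _ => -θ a) (B' := fun _ => 0) (hθ.mono hsub).neg
    (fun s hs => (hd s (le_trans ha hs.1)).neg) le_rfl continuousOn_const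
    (fun s _ => hasDerivWithinAt_const _ _ _)
    (fun s hs => neg_nonpos.mpr (hw s (le_trans ha hs.1))) (Set.right_mem_Icc.mpr hab)
  linarith

theorem strictMonoOn_Ici_of_right_deriv_pos {θ w : ℝ → ℝ} (hθ : ContinuousOn θ (Set.Ici 0))
    (hd : ∀ t, 0 ≤ t → HasDerivWithinAt θ (w t) (Set.Ici t) t) (hw : ∀ t, 0 ≤ t → 0 < w t) :
    StrictMonoOn θ (Set.Ici 0) := by
  have hm := monotoneOn_Ici_of_right_deriv_nonneg hθ hd fun t ht => (hw t ht).le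
  intro a ha b hb hab
  refine (hm ha hb hab.le).lt_of_ne fun heq => ?_
  have hconst : ∀ s ∈ Set.Icc a b, θ s = θ a := fun s hs =>
    le_antisymm (heq ▸ hm (le_trans ha hs.1) hb hs.2) (hm ha (le_trans ha hs.1) hs.1)
  have h1 : HasDerivWithinAt θ 0 (Set.Ici a) a := by
    refine (hasDerivWithinAt_const a (Set.Ici a) (θ a)).congr_of_eventuallyEq ?_ rfl
    filter_upwards [Icc_mem_nhdsGE hab] with s hs using hconst s hs
  have h2 := (uniqueDiffWithinAt_Ici a).eq_deriv _ (hd a ha) h1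
  exact (hw a ha).ne' h2

/-- A continuous curve on the unit circle with right derivative `i μ(t) w(t)` has a continuous angle
with right derivative `w`. -/
theorem exists_angle {mu : ℝ → ℂ} {w : ℝ → ℝ} (hc : ContinuousOn mu (Set.Ici 0))
    (hn : ∀ t, 0 ≤ t → ‖mu t‖ = 1)
    (hd : ∀ t, 0 ≤ t → HasDerivWithinAt mu (Complex.I * mu t * (w t : ℂ)) (Set.Ici t) t) :
    ∃ θ : ℝ → ℝ, θ 0 = 0 ∧ ContinuousOn θ (Set.Ici 0) ∧
      (∀ t, 0 ≤ t → mu t = mu 0 * Complex.exp (Complex.I * (θ t : ℂ))) ∧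
      ∀ t, 0 ≤ t → HasDerivWithinAt θ (w t) (Set.Ici t) t := by
  have hne : ∀ t, 0 ≤ t → mu t ≠ 0 := fun t ht h0 => by
    have := hn t ht
    simp [h0] at this
  have hcm : Continuous fun t : ℝ => mu (max t 0) := by
    rw [← continuousOn_univ]
    exact hc.comp (continuous_id.max continuous_const).continuousOn fun t _ => Set.mem_Ici.mpr (le_max_right _ _)
  let f : C(ℝ, Circle) :=
    ⟨fun t => ⟨mu (max t 0) / mu 0, mem_sphere_zero_iff_norm.mpr (by
      rw [norm_div, hn _ (le_max_right _ _), hn 0 le_rfl, div_one])⟩,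
      (hcm.div_const _).subtype_mk _⟩
  obtain ⟨F, ⟨hF0, hF⟩, -⟩ := Circle.isCoveringMap_exp.existsUnique_continuousMap_lifts f 0 0 (by
    ext
    change (Circle.exp 0 : ℂ) = mu (max 0 0) / mu 0
    rw [max_self, div_self (hne 0 le_rfl), Circle.exp_zero, Circle.coe_one])
  have hexp : ∀ t, 0 ≤ t → mu t = mu 0 * Complex.exp (Complex.I * (F t : ℂ)) := fun t ht => by
    have h1 := congrArg (Subtype.val : Circle → ℂ) (congrFun hF t)
    have h2 : Complex.exp (F t * Complex.I) = mu (max t 0) / mu 0 := by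
      rw [← Circle.coe_exp]; exact h1
    rw [mul_comm Complex.I, h2, max_eq_left ht, mul_div_cancel₀ _ (hne 0 le_rfl)]
  refine ⟨F, hF0, F.continuous.continuousOn, hexp, fun t ht => ?_⟩
  have h1 : HasDerivWithinAt (fun s => mu s / mu t) (Complex.I * (w t : ℂ)) (Set.Ici t) t := by
    have := (hd t ht).div_const (mu t)
    rwa [show Complex.I * mu t * (w t : ℂ) / mu t = Complex.I * (w t : ℂ) by
      field_simp [hne t ht]] at this
  have h2 : HasDerivWithinAt (fun s => Complex.log (mu s / mu t)) (Complex.I * (w t : ℂ))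
      (Set.Ici t) t := by
    have := h1.clog_real (by rw [div_self (hne t ht)]; exact Complex.one_mem_slitPlane)
    rwa [div_self (hne t ht), div_one] at this
  have h3 : HasDerivWithinAt (fun s => F t + (Complex.log (mu s / mu t)).im) (w t)
      (Set.Ici t) t := by
    have := (Complex.imCLM.hasFDerivAt.comp_hasDerivWithinAt t h2).const_add (F t)
    simpa using this
  have hnear : ∀ᶠ s in 𝓝[≥] t, |F s - F t| < Real.pi := by
    have h4 : Filter.Tendsto (fun s => |F s - F t|) (𝓝 t) (𝓝 |F t - F t|) :=
      ((F.continuous.sub continuous_const).abs).tendsto t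
    rw [sub_self, abs_zero] at h4
    exact (h4.eventually_lt_const Real.pi_pos).filter_mono nhdsWithin_le_nhds
  refine h3.congr_of_eventuallyEq ?_ (by simp [div_self (hne t ht)])
  filter_upwards [hnear, self_mem_nhdsWithin] with s hs hst
  have h5 : mu s / mu t = Complex.exp (((F s - F t : ℝ) : ℂ) * Complex.I) := by
    rw [hexp s (ht.trans hst), hexp t ht, mul_div_mul_left _ _ (hne 0 le_rfl), ← Complex.exp_sub]
    congr 1
    push_cast
    ring
  rw [h5, Complex.log_exp]
  · simp
  · simpa using (abs_lt.mp hs).1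
  · simpa using (abs_lt.mp hs).2.le

end Angle

section EigenvalueMotion

variable {d : ℕ} {U : Matrix (Fin d) (Fin d) ℂ} {p : Fin d → ℝ}
  {lam : Fin d → ℝ → ℂ} {x : Fin d → ℝ → EuclideanSpace ℂ (Fin d)}

theorem isEigval_of_weight_eq_zero (hp : ∀ i, 0 ≤ p i) {lam₀ : ℂ}
    (h : IsLeast (weight p '' unitEigvecs U lam₀) 0) (t : ℝ) : IsEigval (U * vMat p t) lam₀ := by
  obtain ⟨y, ⟨hy, hy1⟩, hyw⟩ := h.1
  have h1 := toEuclideanLin_mul_vMat_of_weight_eq_zero (U := U) hp hyw 0 t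
  rw [vMat_zero, Matrix.mul_one, hy] at h1
  refine Module.End.hasEigenvalue_of_hasEigenvector
    (Module.End.hasEigenvector_iff.mpr ⟨Module.End.mem_eigenspace_iff.mpr h1, ?_⟩)
  rw [← norm_ne_zero_iff, hy1]
  exact one_ne_zero

theorem IsEigSystem.finrank_eigenspace (hU : U ∈ Matrix.unitaryGroup (Fin d) ℂ)
    (h : IsEigSystem U p lam x) {t : ℝ} (ht : 0 ≤ t) (μ : ℂ) :
    Module.finrank ℂ (Module.End.eigenspace (Matrix.toEuclideanLin (U * vMat p t)) μ) =
      eigMult (U * vMat p t) μ :=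
  finrank_eigenspace_of_eigenbasis (mul_vMat_unitary hU p t) (h.orthonormal t ht) (h.eigen t ht) μ

theorem IsEigSystem.sub_le_eigMult (hU : U ∈ Matrix.unitaryGroup (Fin d) ℂ)
    (h : IsEigSystem U p lam x) (hp : ∀ i, 0 ≤ p i) (lam₀ : ℂ) {t : ℝ} (ht : 0 ≤ t) :
    eigMult U lam₀ - (Finset.univ.filter fun i => 0 < p i).card ≤
      eigMult (U * vMat p t) lam₀ := by
  have h0 := h.finrank_eigenspace hU le_rfl lam₀
  rw [vMat_zero, Matrix.mul_one] at h0
  let F := Module.End.eigenspace (Matrix.toEuclideanLin U) lam₀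
  let L : F →ₗ[ℂ] ({i // 0 < p i} → ℂ) :=
    { toFun := fun y i => (y : EuclideanSpace ℂ (Fin d)) i
      map_add' := fun _ _ => rfl
      map_smul' := fun _ _ => rfl }
  have h1 := L.finrank_range_add_finrank_ker
  have h2 : Module.finrank ℂ L.range ≤ (Finset.univ.filter fun i => 0 < p i).card := by
    refine (Submodule.finrank_le _).trans ?_
    rw [Module.finrank_fintype_fun_eq_card, Fintype.card_subtype]
  have h3 : L.ker.map F.subtype ≤
      Module.End.eigenspace (Matrix.toEuclideanLin (U * vMat p t)) lam₀ := by
    rintro _ ⟨y, hy, rfl⟩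
    have hw : weight p (y : EuclideanSpace ℂ (Fin d)) = 0 := by
      refine Finset.sum_eq_zero fun i _ => ?_
      rcases (hp i).eq_or_lt with hi | hi
      · rw [← hi, zero_mul]
      · have : (y : EuclideanSpace ℂ (Fin d)) i = 0 :=
          congrFun (LinearMap.mem_ker.mp hy) ⟨i, hi⟩
        simp [this]
    have h4 := toEuclideanLin_mul_vMat_of_weight_eq_zero (U := U) hp hw 0 t
    rw [vMat_zero, Matrix.mul_one, Module.End.mem_eigenspace_iff.mp y.2] at h4
    exact Module.End.mem_eigenspace_iff.mpr h4
  have h5 := Submodule.finrank_mono h3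
  rw [Submodule.finrank_map_subtype_eq, h.finrank_eigenspace hU ht] at h5
  change Module.finrank ℂ L.range + Module.finrank ℂ L.ker = Module.finrank ℂ F at h1
  have h6 : Module.finrank ℂ F = eigMult U lam₀ := h0
  omega

theorem IsEigSystem.isEigval_of_eigMult_pos (hU : U ∈ Matrix.unitaryGroup (Fin d) ℂ)
    (h : IsEigSystem U p lam x) {t : ℝ} (ht : 0 ≤ t) {μ : ℂ}
    (hpos : 0 < eigMult (U * vMat p t) μ) : IsEigval (U * vMat p t) μ := by
  rw [((h.isEigvalCurves hU).isEigvalList t ht).eigMult_eq_card, Fintype.card_pos_iff] at hpos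
  obtain ⟨j, hj⟩ := hpos
  exact (h.isEigval_iff hU ht).mpr ⟨j, hj⟩

theorem IsEigSystem.exists_monotone_angle (hU : U ∈ Matrix.unitaryGroup (Fin d) ℂ)
    (h : IsEigSystem U p lam x) (hp : ∀ i, 0 ≤ p i) {mu : ℝ → ℂ}
    (hmu : ∀ t : ℝ, 0 ≤ t → IsEigval (U * vMat p t) (mu t)) (hc : ContinuousOn mu (Set.Ici 0)) :
    ∃ θ : ℝ → ℝ, θ 0 = 0 ∧ ContinuousOn θ (Set.Ici 0) ∧ MonotoneOn θ (Set.Ici 0) ∧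
      ∀ t : ℝ, 0 ≤ t →
        ‖mu t‖ = 1 ∧ mu t = mu 0 * Complex.exp (Complex.I * (θ t : ℂ)) := by
  have hsel : ∀ t, 0 ≤ t → ∃ a, mu t = lam a t := fun t ht => by
    obtain ⟨a, ha⟩ := (h.isEigval_iff hU ht).mp (hmu t ht)
    exact ⟨a, ha.symm⟩
  have hn : ∀ t, 0 ≤ t → ‖mu t‖ = 1 := fun t ht => by
    obtain ⟨a, ha⟩ := hsel t ht
    rw [ha, h.norm_lam hU ht]
  have hd : ∀ t, 0 ≤ t → ∃ w : ℝ, 0 ≤ w ∧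
      HasDerivWithinAt mu (Complex.I * mu t * (w : ℂ)) (Set.Ici t) t := fun t ht => by
    have hsub : Set.Ici t ⊆ Set.Ici 0 := Set.Ici_subset_Ici.mpr ht
    obtain ⟨a, ha, hda⟩ := exists_hasDerivWithinAt_of_selection (hc.mono hsub)
      (fun a => (h.hasDerivWithinAt hU ht a).mono hsub) fun s hs => hsel s (ht.trans hs)
    exact ⟨weight p (x a t), weight_nonneg hp _, ha ▸ hda⟩
  choose! w hw hwd using hd
  obtain ⟨θ, h0, hθ, he, hθd⟩ := exists_angle hc hn hwd
  exact ⟨θ, h0, hθ, monotoneOn_Ici_of_right_deriv_nonneg hθ hθd hw,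
    fun t ht => ⟨hn t ht, he t ht⟩⟩

/-- An eigenvalue branch whose velocity vanishes somewhere is constant. -/
theorem IsEigSystem.lam_eq_of_weight_eq_zero (hU : U ∈ Matrix.unitaryGroup (Fin d) ℂ)
    (h : IsEigSystem U p lam x) (hp : ∀ i, 0 ≤ p i) (j : Fin d) {t₀ : ℝ} (ht₀ : 0 ≤ t₀)
    (h0 : weight p (x j t₀) = 0) : ∀ t, 0 ≤ t → lam j t = lam j t₀ := by
  have hlc := h.continuousOn_lam hU j
  let T : Set (Set.Ici (0 : ℝ)) := {t | weight p (x j t) = 0 ∧ lam j t = lam j t₀}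
  have hclosed : IsClosed T := by
    have h1 : Continuous fun t : Set.Ici (0 : ℝ) => weight p (x j t) :=
      continuous_weight.comp (continuousOn_iff_continuous_domRestrict.mp (h.continuousOn j))
    have h2 : Continuous fun t : Set.Ici (0 : ℝ) => lam j t :=
      continuousOn_iff_continuous_domRestrict.mp hlc
    exact (isClosed_eq h1 continuous_const).inter (isClosed_eq h2 continuous_const)
  have hopen : IsOpen T := by
    rw [isOpen_iff_mem_nhds]
    rintro ⟨t₁, ht₁⟩ ⟨hw, hl⟩
    have hv : ∀ t, 0 ≤ t → Matrix.toEuclideanLin (U * vMat p t) (x j t₁) =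
        lam j t₀ • x j t₁ := fun t ht => by
      rw [toEuclideanLin_mul_vMat_of_weight_eq_zero hp hw t₁ t, h.eigen t₁ ht₁ j]
      exact congrArg (· • x j t₁) hl
    have hinner : ∀ᶠ t in 𝓝[Set.Ici 0] t₁, inner ℂ (x j t₁) (x j t) ≠ 0 := by
      have h1 : Filter.Tendsto (fun t => inner ℂ (x j t₁) (x j t)) (𝓝[Set.Ici 0] t₁)
          (𝓝 (inner ℂ (x j t₁) (x j t₁))) := tendsto_const_nhds.inner (h.continuousOn j t₁ ht₁)
      exact h1.eventually_ne (inner_self_ne_zero.mpr ((h.orthonormal t₁ ht₁).ne_zero j))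
    have hlam : ∀ᶠ t in 𝓝[Set.Ici 0] t₁, lam j t = lam j t₀ := by
      filter_upwards [hinner, self_mem_nhdsWithin] with t ht ht0
      by_contra hcon
      exact ht (inner_eq_zero_of_eigenvectors (mul_vMat_unitary hU p t)
        ((h.orthonormal t₁ ht₁).ne_zero j) (hv t ht0) (h.eigen t ht0 j) (Ne.symm hcon))
    have hboth : ∀ᶠ t in 𝓝[Set.Ici 0] t₁, weight p (x j t) = 0 ∧ lam j t = lam j t₀ := by
      filter_upwards [eventually_eventually_nhdsWithin.mpr hlam, hlam, self_mem_nhdsWithin]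
        with t hev ht ht0
      refine ⟨?_, ht⟩
      have h1 : HasDerivWithinAt (lam j) 0 (Set.Ici 0) t :=
        (hasDerivWithinAt_const t (Set.Ici 0) (lam j t₀)).congr_of_eventuallyEq hev ht
      have h2 := (uniqueDiffOn_Ici 0 t ht0).eq_deriv _ (h.hasDerivWithinAt hU ht0 j) h1
      have h3 : lam j t ≠ 0 := fun h4 => by
        have := h.norm_lam hU ht0 j
        simp [h4] at this
      simpa [h3] using h2
    rw [nhds_subtype_eq_comap, Filter.mem_comap]
    obtain ⟨V, hV, hVsub⟩ := mem_nhdsWithin_iff_exists_mem_nhds_inter.mp hboth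
    exact ⟨V, hV, fun t ht => hVsub ⟨ht, t.2⟩⟩
  have hpre : PreconnectedSpace (Set.Ici (0 : ℝ)) :=
    isPreconnected_iff_preconnectedSpace.mp isPreconnected_Ici
  rcases isClopen_iff.mp ⟨hclosed, hopen⟩ with hT | hT
  · exact absurd (show (⟨t₀, ht₀⟩ : Set.Ici (0 : ℝ)) ∈ T from ⟨h0, rfl⟩) (by simp [hT])
  · intro t ht
    have : (⟨t, ht⟩ : Set.Ici (0 : ℝ)) ∈ T := by rw [hT]; trivial
    exact this.2

theorem IsEigSystem.constant_or_strictMono (hU : U ∈ Matrix.unitaryGroup (Fin d) ℂ)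
    (h : IsEigSystem U p lam x) (hp : ∀ i, 0 ≤ p i) (j : Fin d) :
    (∀ t : ℝ, 0 ≤ t → lam j t = lam j 0) ∨
      ∃ θ : ℝ → ℝ, θ 0 = 0 ∧ ContinuousOn θ (Set.Ici 0) ∧ StrictMonoOn θ (Set.Ici 0) ∧
        ∀ t : ℝ, 0 ≤ t → lam j t = lam j 0 * Complex.exp (Complex.I * (θ t : ℂ)) := by
  by_cases hz : ∃ t, 0 ≤ t ∧ weight p (x j t) = 0
  · obtain ⟨t₀, ht₀, h0⟩ := hz
    have h1 := h.lam_eq_of_weight_eq_zero hU hp j ht₀ h0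
    exact Or.inl fun t ht => (h1 t ht).trans (h1 0 le_rfl).symm
  · right
    push Not at hz
    obtain ⟨θ, h0, hθ, he, hθd⟩ := exists_angle (w := fun t => weight p (x j t))
      (h.continuousOn_lam hU j) (fun t ht => h.norm_lam hU ht j)
      fun t ht => (h.hasDerivWithinAt hU ht j).mono (Set.Ici_subset_Ici.mpr ht)
    exact ⟨θ, h0, hθ, strictMonoOn_Ici_of_right_deriv_pos hθ hθd
      fun t ht => lt_of_le_of_ne (weight_nonneg hp _) (hz t ht).symm, he⟩

theorem approxNearZero_exp {f : ℝ → ℂ} {lam₀ : ℂ} {w : ℝ} (h0 : f 0 = lam₀)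
    (hf : HasDerivWithinAt f (Complex.I * lam₀ * (w : ℂ)) (Set.Ici 0) 0) :
    ApproxNearZero f fun t => lam₀ * Complex.exp (Complex.I * (w : ℂ) * (t : ℂ)) := by
  refine ⟨by simp [h0], _, hf, ?_⟩
  have h1 : HasDerivAt (fun t : ℝ => (t : ℂ)) 1 0 := by
    simpa using (hasDerivAt_id (0 : ℝ)).ofReal_comp
  have h2 := ((h1.const_mul (Complex.I * (w : ℂ))).cexp.const_mul lam₀).hasDerivWithinAt
    (s := Set.Ici 0)
  have h3 : Complex.I * lam₀ * (w : ℂ) = lam₀ * (Complex.exp (Complex.I * (w : ℂ) * ((0 : ℝ) : ℂ)) *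
      (Complex.I * (w : ℂ) * 1)) := by
    simp
    ring
  rw [h3]
  exact h2

theorem IsEigSystem.approxNearZero_of_simple (hU : U ∈ Matrix.unitaryGroup (Fin d) ℂ)
    (h : IsEigSystem U p lam x) {lam₀ : ℂ} (hk : eigMult U lam₀ = 1)
    {x₁ : EuclideanSpace ℂ (Fin d)} (hx₁ : x₁ ∈ unitEigvecs U lam₀) {mu : ℝ → ℂ}
    (hmu : ∀ t : ℝ, 0 ≤ t → IsEigval (U * vMat p t) (mu t))
    (hlim : Filter.Tendsto mu (𝓝[≥] 0) (𝓝 lam₀)) :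
    ApproxNearZero mu fun t =>
      lam₀ * Complex.exp (Complex.I * (t : ℂ) * (weight p x₁ : ℂ)) := by
  have hcard := ((h.isEigvalCurves hU).isEigvalList 0 le_rfl).eigMult_eq_card lam₀
  rw [vMat_zero, Matrix.mul_one, hk, eq_comm, Fintype.card_eq_one_iff] at hcard
  obtain ⟨⟨a, ha⟩, huniq⟩ := hcard
  have hother : ∀ j, j ≠ a → lam j 0 ≠ lam₀ := fun j hj hj0 =>
    hj (congrArg Subtype.val (huniq ⟨j, hj0⟩))
  have heq : ∀ᶠ s in 𝓝[≥] (0 : ℝ), mu s = lam a s := by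
    have h1 : ∀ᶠ s in 𝓝[≥] (0 : ℝ), ∀ j, j ≠ a → lam j s ≠ mu s := by
      rw [Filter.eventually_all]
      intro j
      by_cases hj : j = a
      · exact Filter.Eventually.of_forall fun _ hne => absurd hj hne
      · have h2 : Filter.Tendsto (lam j) (𝓝[≥] 0) (𝓝 (lam j 0)) :=
          h.continuousOn_lam hU j 0 Set.self_mem_Ici
        exact ((h2.sub hlim).eventually_ne (sub_ne_zero.mpr (hother j hj))).mono
          fun s hs _ => sub_ne_zero.mp hs
    filter_upwards [h1, self_mem_nhdsWithin] with s hs hs0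
    obtain ⟨j, hj⟩ := (h.isEigval_iff hU hs0).mp (hmu s hs0)
    by_cases hja : j = a
    · rw [← hj, hja]
    · exact absurd hj (hs j hja)
  have h0 : mu 0 = lam a 0 := heq.self_of_nhdsWithin Set.self_mem_Ici
  have hspan := mem_span_of_eigenbasis (mul_vMat_unitary hU p 0) (h.orthonormal 0 le_rfl)
    (h.eigen 0 le_rfl) (μ := lam₀) (x := x₁) (by rw [vMat_zero, Matrix.mul_one]; exact hx₁.1)
  have hrange : (Set.range fun j : {j // lam j 0 = lam₀} => x j 0) = {x a 0} := by
    ext v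
    constructor
    · rintro ⟨j, rfl⟩
      rw [huniq j]; rfl
    · rintro rfl
      exact ⟨⟨a, ha⟩, rfl⟩
  rw [hrange, Submodule.mem_span_singleton] at hspan
  obtain ⟨c, hc⟩ := hspan
  have hcn : ‖c‖ = 1 := by
    have h2 := hx₁.2
    rwa [← hc, norm_smul, (h.orthonormal 0 le_rfl).norm_eq_one a, mul_one] at h2
  have hw : weight p x₁ = weight p (x a 0) := by
    rw [← hc, weight_smul, hcn, one_pow, one_mul]
  have hder := (h.hasDerivWithinAt hU le_rfl a).congr_of_eventuallyEq heq h0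
  rw [ha, ← hw] at hder
  have := approxNearZero_exp (h0.trans ha) hder
  simpa only [mul_right_comm] using this

theorem sum_norm_deriv_eq_one (hU : U ∈ Matrix.unitaryGroup (Fin d) ℂ) (hp : ∀ i, 0 ≤ p i)
    (hp1 : ∑ i, p i = 1) {t : ℝ} {a c : Fin d → ℂ} {y : Fin d → EuclideanSpace ℂ (Fin d)}
    (hy : Orthonormal ℂ y)
    (ha : ∀ j, Matrix.toEuclideanLin (U * vMat p t) (y j) = a j • y j)
    (hc : ∀ j, c j = Complex.I * a j * (weight p (y j) : ℂ)) : ∑ j, ‖c j‖ = 1 := by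
  rw [← hp1, ← sum_weight_orthonormal (p := p) hy]
  refine Finset.sum_congr rfl fun j _ => ?_
  rw [hc, norm_mul, norm_mul, Complex.norm_I,
    norm_eq_one_of_unitary_eigenvector (mul_vMat_unitary hU p t) (hy.ne_zero j) (ha j),
    Complex.norm_real, Real.norm_of_nonneg (weight_nonneg hp _)]
  ring

end EigenvalueMotion

section DegenerateEigenvalue

variable {d k : ℕ} {U : Matrix (Fin d) (Fin d) ℂ} {p : Fin d → ℝ}
  {lam : Fin d → ℝ → ℂ} {x : Fin d → ℝ → EuclideanSpace ℂ (Fin d)} {lam₀ : ℂ}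
  {W : Matrix (Fin d) (Fin k) ℂ}

theorem IsEigIsometry.toEuclideanLin_eigen (hW : IsEigIsometry U lam₀ W)
    (v : EuclideanSpace ℂ (Fin k)) :
    Matrix.toEuclideanLin U (Matrix.toEuclideanLin W v) = lam₀ • Matrix.toEuclideanLin W v := by
  rw [← LinearMap.comp_apply, ← Matrix.toLpLin_mul, hW.eigen, map_smul, LinearMap.smul_apply]

theorem IsEigIsometry.mem_unitEigvecs (hW : IsEigIsometry U lam₀ W)
    {v : EuclideanSpace ℂ (Fin k)} (hv : ‖v‖ = 1) :
    Matrix.toEuclideanLin W v ∈ unitEigvecs U lam₀ :=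
  ⟨hW.toEuclideanLin_eigen v, by rw [norm_toEuclideanLin hW.isometry, hv]⟩

theorem IsEigSystem.exists_preimage (hU : U ∈ Matrix.unitaryGroup (Fin d) ℂ)
    (h : IsEigSystem U p lam x) (hW : IsEigIsometry U lam₀ W) {y : EuclideanSpace ℂ (Fin d)}
    (hy : Matrix.toEuclideanLin U y = lam₀ • y) : ∃ v, Matrix.toEuclideanLin W v = y := by
  have h0 := h.finrank_eigenspace hU le_rfl lam₀
  rw [vMat_zero, Matrix.mul_one, hW.card_eq] at h0
  have hinj : Function.Injective (Matrix.toEuclideanLin W) := by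
    rw [injective_iff_map_eq_zero]
    intro v hv
    rw [← norm_eq_zero, ← norm_toEuclideanLin hW.isometry, hv, norm_zero]
  have hle : (Matrix.toEuclideanLin W).range ≤
      Module.End.eigenspace (Matrix.toEuclideanLin U) lam₀ := by
    rintro _ ⟨v, rfl⟩
    exact Module.End.mem_eigenspace_iff.mpr (hW.toEuclideanLin_eigen v)
  have heq := Submodule.eq_of_le_of_finrank_eq hle (by
    rw [LinearMap.finrank_range_of_inj hinj, h0, finrank_euclideanSpace_fin])
  have hmem : y ∈ (Matrix.toEuclideanLin W).range := by
    rw [heq]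
    exact Module.End.mem_eigenspace_iff.mpr hy
  exact hmem

theorem toEuclideanLin_compression_apply (v : EuclideanSpace ℂ (Fin k)) :
    Matrix.toEuclideanLin (Wᴴ * dPlus p * W) v = LinearMap.adjoint (Matrix.toEuclideanLin W)
      (Matrix.toEuclideanLin (dPlus p) (Matrix.toEuclideanLin W v)) := by
  rw [Matrix.toLpLin_mul 2 2 2, Matrix.toLpLin_mul 2 2 2,
    ← Matrix.toEuclideanLin_conjTranspose_eq_adjoint]
  rfl

/-- The eigenvectors at `t = 0` of an eigensystem diagonalize the compression of `D₊`. -/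
theorem IsEigSystem.exists_equiv_compression (hU : U ∈ Matrix.unitaryGroup (Fin d) ℂ)
    (h : IsEigSystem U p lam x) (hW : IsEigIsometry U lam₀ W) {q : Fin k → ℝ}
    (hq : IsEigvalList (Wᴴ * dPlus p * W) fun j => (q j : ℂ)) :
    ∃ e : Fin k ≃ {j : Fin d // lam j 0 = lam₀}, ∀ m, weight p (x (e m) 0) = q m ∧
      ∃ v ∈ unitEigvecs (Wᴴ * dPlus p * W) (q m : ℂ),
        x (e m) 0 = Matrix.toEuclideanLin W v := by
  have hcard := ((h.isEigvalCurves hU).isEigvalList 0 le_rfl).eigMult_eq_card lam₀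
  rw [vMat_zero, Matrix.mul_one, hW.card_eq] at hcard
  obtain ⟨e₀⟩ : Nonempty (Fin k ≃ {j : Fin d // lam j 0 = lam₀}) := by
    rw [← Fintype.card_eq, ← hcard, Fintype.card_fin]
  have hx : ∀ m, ∃ v, Matrix.toEuclideanLin W v = x (e₀ m) 0 := fun m => by
    refine h.exists_preimage hU hW ?_
    have := h.eigen 0 le_rfl (e₀ m)
    rwa [vMat_zero, Matrix.mul_one, (e₀ m).2] at this
  choose v hv using hx
  have hvo : Orthonormal ℂ v := by
    rw [orthonormal_iff_ite]
    intro m m'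
    rw [← inner_toEuclideanLin_toEuclideanLin hW.isometry, hv, hv,
      orthonormal_iff_ite.mp (h.orthonormal 0 le_rfl)]
    by_cases hm : m = m'
    · simp [hm]
    · have : (e₀ m : Fin d) ≠ e₀ m' := fun h' => hm (e₀.injective (Subtype.ext h'))
      simp [hm, this]
  have hQ : ∀ m, Matrix.toEuclideanLin (Wᴴ * dPlus p * W) (v m) =
      (weight p (x (e₀ m) 0) : ℂ) • v m := by
    intro m
    obtain ⟨b, hb⟩ := hvo.exists_orthonormalBasis (by simp)
    refine b.repr.injective (PiLp.ext fun m' => ?_)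
    rw [b.repr_apply_apply, b.repr_apply_apply, hb, toEuclideanLin_compression_apply, LinearMap.adjoint_inner_right, hv, hv,
      inner_smul_right, orthonormal_iff_ite.mp hvo]
    by_cases hm : m' = m
    · subst hm
      rw [inner_dPlus_self, if_pos rfl, mul_one]
    · rw [if_neg hm, mul_zero]
      exact h.inner_dPlus_eq_zero hU le_rfl
        (fun h' => hm (e₀.injective (Subtype.ext h'))) ((e₀ m').2.trans (e₀ m).2.symm)
  obtain ⟨σ, hσ⟩ := exists_equiv_of_map_univ_eq (hq.symm.trans (isEigvalList_of_eigenbasis hvo hQ))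
  have hσ' : ∀ m, weight p (x (e₀ (σ m)) 0) = q m := fun m => by exact_mod_cast hσ m
  refine ⟨σ.trans e₀, fun m => ⟨hσ' m, v (σ m), ⟨?_, hvo.norm_eq_one _⟩, (hv _).symm⟩⟩
  rw [hQ, hσ']

theorem ContinuousOn.tendsto_nhdsGT_iff {f : ℝ → ℂ} (hf : ContinuousOn f (Set.Ici 0)) {c : ℂ} :
    Filter.Tendsto f (𝓝[>] 0) (𝓝 c) ↔ f 0 = c := by
  have h1 : Filter.Tendsto f (𝓝[>] 0) (𝓝 (f 0)) :=
    (hf 0 Set.self_mem_Ici).tendsto.mono_left (nhdsWithin_mono _ Set.Ioi_subset_Ici_self)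
  exact ⟨fun h => tendsto_nhds_unique h1 h, fun h => h ▸ h1⟩

theorem IsEigSystem.exists_equiv_approx (hU : U ∈ Matrix.unitaryGroup (Fin d) ℂ)
    (h : IsEigSystem U p lam x) (hW : IsEigIsometry U lam₀ W) {q : Fin k → ℝ}
    (hq : IsEigvalList (Wᴴ * dPlus p * W) fun j => (q j : ℂ)) :
    ∃ e : Fin k ≃ {j : Fin d // Filter.Tendsto (lam j) (𝓝[>] 0) (𝓝 lam₀)},
      ∀ j, (ApproxNearZero (lam (e j)) fun t =>
          lam₀ * Complex.exp (Complex.I * (q j : ℂ) * (t : ℂ))) ∧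
        ∃ v ∈ unitEigvecs (Wᴴ * dPlus p * W) (q j : ℂ),
          x (e j) 0 = Matrix.toEuclideanLin W v := by
  obtain ⟨e, he⟩ := h.exists_equiv_compression hU hW hq
  refine ⟨e.trans (Equiv.subtypeEquivRight fun j =>
    (h.continuousOn_lam hU j).tendsto_nhdsGT_iff.symm), fun m => ⟨?_, (he m).2⟩⟩
  have h1 := h.hasDerivWithinAt hU le_rfl (e m)
  rw [(he m).1, (e m).2] at h1
  exact approxNearZero_exp (e m).2 h1

theorem IsEigvalCurves.exists_equiv_approx (hU : U ∈ Matrix.unitaryGroup (Fin d) ℂ)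
    (h : IsEigSystem U p lam x) (hW : IsEigIsometry U lam₀ W) {q : Fin k → ℝ}
    (hq : IsEigvalList (Wᴴ * dPlus p * W) fun j => (q j : ℂ)) {mu : Fin d → ℝ → ℂ}
    (hmu : IsEigvalCurves U p mu) :
    ∃ e : Fin k ≃ {j : Fin d // Filter.Tendsto (mu j) (𝓝[>] 0) (𝓝 lam₀)},
      ∀ j, ApproxNearZero (mu (e j)) fun t =>
        lam₀ * Complex.exp (Complex.I * (q j : ℂ) * (t : ℂ)) := by
  obtain ⟨e, he⟩ := h.exists_equiv_compression hU hW hq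
  obtain ⟨σ, hσ⟩ := hmu.exists_perm_hasDerivWithinAt hU h le_rfl
  have hiff : ∀ j, lam j 0 = lam₀ ↔
      Filter.Tendsto (mu (σ.symm j)) (𝓝[>] 0) (𝓝 lam₀) := fun j => by
    rw [(hmu.continuousOn _).tendsto_nhdsGT_iff, (hσ _).1, Equiv.apply_symm_apply]
  refine ⟨e.trans (Equiv.subtypeEquiv σ.symm hiff), fun m => ?_⟩
  obtain ⟨h0, h1⟩ := hσ (σ.symm (e m))
  rw [Equiv.apply_symm_apply] at h0 h1
  rw [(he m).1, (e m).2] at h1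
  exact approxNearZero_exp (h0.trans (e m).2) h1

end DegenerateEigenvalue

theorem theorem1 (d : ℕ) (U : Matrix (Fin d) (Fin d) ℂ)
    (hU : U ∈ Matrix.unitaryGroup (Fin d) ℂ)
    (p : Fin d → ℝ) (hp : ∀ i, 0 ≤ p i) (hp1 : ∑ i, p i = 1)
    (lam₀ : ℂ) (hlam₀ : IsEigval U lam₀) (k : ℕ) (hk : eigMult U lam₀ = k) :
    -- continuous branches of eigenvalues and orthonormal eigenvectors exist
    (∃ lam x, IsEigSystem U p lam x) ∧
    -- and the eigenvalues of any such system form a continuous labelling of the spectrum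
    (∀ lam x, IsEigSystem U p lam x → IsEigvalCurves U p lam) ∧
    -- (a)
    (IsLeast (weight p '' unitEigvecs U lam₀) 0 →
      ∀ t : ℝ, 0 ≤ t → IsEigval (U * vMat p t) lam₀) ∧
    -- (b)
    (∀ l : ℕ, (Finset.univ.filter fun i => 0 < p i).card = l → l < k →
      ∀ t : ℝ, 0 ≤ t →
        IsEigval (U * vMat p t) lam₀ ∧ k - l ≤ eigMult (U * vMat p t) lam₀) ∧
    -- (c) for every continuous choice of an eigenvalue
    (∀ mu : ℝ → ℂ, (∀ t : ℝ, 0 ≤ t → IsEigval (U * vMat p t) (mu t)) →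
      ContinuousOn mu (Set.Ici 0) →
      ∃ θ : ℝ → ℝ, θ 0 = 0 ∧ ContinuousOn θ (Set.Ici 0) ∧ MonotoneOn θ (Set.Ici 0) ∧
        ∀ t : ℝ, 0 ≤ t →
          ‖mu t‖ = 1 ∧ mu t = mu 0 * Complex.exp (Complex.I * (θ t : ℂ))) ∧
    -- (c) for branches with continuous eigenvectors: strict movement or rest
    (∀ lam x, IsEigSystem U p lam x → ∀ j,
      (∀ t : ℝ, 0 ≤ t → lam j t = lam j 0) ∨
      ∃ θ : ℝ → ℝ, θ 0 = 0 ∧ ContinuousOn θ (Set.Ici 0) ∧ StrictMonoOn θ (Set.Ici 0) ∧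
        ∀ t : ℝ, 0 ≤ t → lam j t = lam j 0 * Complex.exp (Complex.I * (θ t : ℂ))) ∧
    -- (d)
    (k = 1 → ∀ x₁ ∈ unitEigvecs U lam₀, ∀ mu : ℝ → ℂ,
      (∀ t : ℝ, 0 ≤ t → IsEigval (U * vMat p t) (mu t)) →
      Filter.Tendsto mu (𝓝[≥] 0) (𝓝 lam₀) →
      ApproxNearZero mu fun t =>
        lam₀ * Complex.exp (Complex.I * (t : ℂ) * (weight p x₁ : ℂ))) ∧
    -- (e)
    (∀ W : Matrix (Fin d) (Fin k) ℂ, IsEigIsometry U lam₀ W →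
      ∀ q : Fin k → ℝ, Monotone q → IsEigvalList (Wᴴ * dPlus p * W) (fun j => (q j : ℂ)) →
      (∀ lam, IsEigvalCurves U p lam →
        ∃ e : Fin k ≃ {j : Fin d // Filter.Tendsto (lam j) (𝓝[>] 0) (𝓝 lam₀)},
          ∀ j, ApproxNearZero (lam (e j)) fun t =>
            lam₀ * Complex.exp (Complex.I * (q j : ℂ) * (t : ℂ))) ∧
      (∀ lam x, IsEigSystem U p lam x →
        ∃ e : Fin k ≃ {j : Fin d // Filter.Tendsto (lam j) (𝓝[>] 0) (𝓝 lam₀)},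
          ∀ j, (ApproxNearZero (lam (e j)) fun t =>
              lam₀ * Complex.exp (Complex.I * (q j : ℂ) * (t : ℂ))) ∧
            ∃ v ∈ unitEigvecs (Wᴴ * dPlus p * W) (q j : ℂ),
              x (e j) 0 = Matrix.toEuclideanLin W v) ∧
      (∀ j, ∀ v ∈ unitEigvecs (Wᴴ * dPlus p * W) (q j : ℂ),
        Matrix.toEuclideanLin W v ∈ unitEigvecs U lam₀)) ∧
    -- (f) for branches with continuous eigenvectors
    (∀ lam x, IsEigSystem U p lam x → ∀ t : ℝ, 0 ≤ t →
      (∀ j, HasDerivWithinAt (lam j)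
        (Complex.I * lam j t * (weight p (x j t) : ℂ)) (Set.Ici 0) t) ∧
      ∑ j, ‖derivWithin (lam j) (Set.Ici 0) t‖ = 1) ∧
    -- (f) for every continuous labelling: right derivatives
    (∀ lam, IsEigvalCurves U p lam → ∀ t : ℝ, 0 ≤ t →
      (∃ y : Fin d → EuclideanSpace ℂ (Fin d), Orthonormal ℂ y ∧
        (∀ j, Matrix.toEuclideanLin (U * vMat p t) (y j) = lam j t • y j) ∧
        ∀ j, HasDerivWithinAt (lam j)
          (Complex.I * lam j t * (weight p (y j) : ℂ)) (Set.Ici t) t) ∧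
      ∑ j, ‖derivWithin (lam j) (Set.Ici t) t‖ = 1) := by
  obtain ⟨lam, x, hsys⟩ := exists_isEigSystem hU p
  refine ⟨⟨lam, x, hsys⟩, fun _ _ h => h.isEigvalCurves hU,
    fun hleast t _ => isEigval_of_weight_eq_zero hp hleast t, ?_,
    fun mu hmu hc => hsys.exists_monotone_angle hU hp hmu hc,
    fun _ _ h j => h.constant_or_strictMono hU hp j,
    fun hk1 x₁ hx₁ mu hmu hlim =>
      hsys.approxNearZero_of_simple hU (hk.trans hk1) hx₁ hmu hlim, ?_, ?_, ?_⟩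
  · intro l hl hlk t ht
    have h1 := hsys.sub_le_eigMult hU hp lam₀ ht
    rw [hk, hl] at h1
    exact ⟨hsys.isEigval_of_eigMult_pos hU ht (lt_of_lt_of_le (Nat.sub_pos_of_lt hlk) h1), h1⟩
  · intro W hW q _ hq
    exact ⟨fun mu hmu => hmu.exists_equiv_approx hU hsys hW hq,
      fun _ _ h => h.exists_equiv_approx hU hW hq,
      fun j v hv => hW.mem_unitEigvecs hv.2⟩
  · intro lam x h t ht
    refine ⟨fun j => h.hasDerivWithinAt hU ht j, ?_⟩
    exact sum_norm_deriv_eq_one hU hp hp1 (h.orthonormal t ht) (h.eigen t ht) fun j =>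
      (h.hasDerivWithinAt hU ht j).derivWithin (uniqueDiffOn_Ici 0 t ht)
  · intro mu hmu t ht
    obtain ⟨σ, hσ⟩ := hmu.exists_perm_hasDerivWithinAt hU hsys ht
    have hy : Orthonormal ℂ fun j => x (σ j) t :=
      (hsys.orthonormal t ht).comp σ σ.injective
    have he : ∀ j, Matrix.toEuclideanLin (U * vMat p t) (x (σ j) t) = mu j t • x (σ j) t :=
      fun j => by rw [(hσ j).1, hsys.eigen t ht]
    have hd : ∀ j, HasDerivWithinAt (mu j)
        (Complex.I * mu j t * (weight p (x (σ j) t) : ℂ)) (Set.Ici t) t :=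
      fun j => by rw [(hσ j).1]; exact (hσ j).2
    exact ⟨⟨_, hy, he, hd⟩, sum_norm_deriv_eq_one hU hp hp1 hy he fun j =>
      (hd j).derivWithin (uniqueDiffWithinAt_Ici t)⟩
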